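/- Let $K$ be a field, $d\ge 0$ an integer and $\mathfrak{L}^-$ a set. For a set $A$, a (left) multi-Novikov algebra is a $K$-vector space with bilinear products $x\triangleright_a y$, $a\in A$, such that for all $a,b\in A$ and all $x,y,z$ $$(x\triangleright_a y)\triangleright_b z-x\triangleright_a(y\triangleright_b z)=(y\triangleright_a x)\triangleright_b z-y\triangleright_a(x\triangleright_b z),$$ $$(x\triangleright_a y)\triangleright_b z-x\triangleright_a(y\triangleright_b z)=(x\triangleright_b y)\triangleright_a z-x\triangleright_b(y\triangleright_a z),$$ $$(x\triangleright_a y)\triangleright_b z=(x\triangleright_b z)\triangleright_a y.$$ Let $\mathcal{A}$ be the unital associative $K$-algebra generated by letters $\mathbf{n}\in\mathbb{N}^{d+1}$ and $d_0,\dots,d_d$ subject to the relations $$d_id_j=d_jd_i,\qquad \mathbf{n}\mathbf{n}'=\mathbf{n}'\mathbf{n},\qquad d_i\mathbf{n}=n_i(\mathbf{n}-e_i)+\mathbf{n}d_i,$$ where $\mathbf{n}-e_i$ is a letter and the term $n_i(\mathbf{n}-e_i)$ is absent if $n_i=0$. The algebra of SPDE multi-indices is the commutative polynomial algebra in variables $z_{(\mathfrak{l},\alpha)}$,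 $\mathfrak{l}\in\mathfrak{L}^-$, $\alpha\in\mathcal{A}$, modulo the relations expressing that $z_{(\mathfrak{l},\alpha)}$ is linear in $\alpha$. Let $D^{(\mathbf{n})}$ and $\partial_i$ be its derivations determined by $D^{(\mathbf{n})}z_{(\mathfrak{l},\alpha)}=z_{(\mathfrak{l},\mathbf{n}\alpha)}$ and $\partial_i z_{(\mathfrak{l},\alpha)}=z_{(\mathfrak{l},d_i\alpha)}$; the $D^{(\mathbf{n})}$ commute with each other, and $\partial_iD^{(\mathbf{n})}=D^{(\mathbf{n})}\partial_i+n_iD^{(\mathbf{n}-e_i)}$. For a word $\alpha$ let $|\alpha|$ be the number of its letters that belong to $\mathbb{N}^{d+1}$. A monomial $\prod z_{(\mathfrak{l},\alpha)}^{\beta(\mathfrak{l},\alpha)}$ in variables $z_{(\mathfrak{l},\alpha)}$ with $\alpha$ a word is populated if $$\sum_{(\mathfrak{l},\alpha)}(1-|\alpha|)\,\beta(\mathfrak{l},\alpha)=1,$$ and $\mathcal{M}_{\mathcal{R}}$ is the linear span of the populated monomials. It is a multi-Novikov algebra for the products $x\triangleright_{\mathbf{n}}y=x\,D^{(\mathbf{n})}(y)$,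 $\mathbf{n}\in\mathbb{N}^{d+1}$. **Theorem.** The multi-Novikov algebra $\mathcal{M}_{\mathcal{R}}$ of populated SPDE multi-indices is isomorphic to the free multi-Novikov algebra (with products indexed by $\mathbb{N}^{d+1}$) generated by the set $\mathbb{N}^{d+1}\times\mathfrak{L}^-$. More precisely, there is an isomorphism sending the generator $(k,\mathfrak{l})$ to the variable $z_{(\mathfrak{l},\,d_0^{k_0}\cdots d_d^{k_d})}=\partial_0^{k_0}\cdots\partial_d^{k_d}z_{(\mathfrak{l},1)}$. -/

import Mathlib

/-! ### Multi-Novikov algebras -/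

/-- A (left) multi-Novikov algebra over `K` with operations indexed by `A`: a vector space `V`
with bilinear products `x ▷ₐ y = op a x y`, `a ∈ A`, satisfying the three families of
multi-Novikov identities. -/
class MultiNovikovAlgebra (K A V : Type*) [Field K] [AddCommGroup V] [Module K V] where
  op : A → V →ₗ[K] V →ₗ[K] V
  exchange_args : ∀ (a b : A) (x y z : V),
    op b (op a x y) z - op a x (op b y z) = op b (op a y x) z - op a y (op b x z)
  exchange_ops : ∀ (a b : A) (x y z : V),
    op b (op a x y) z - op a x (op b y z) = op a (op b x y) z - op b x (op a y z)
  right_comm : ∀ (a b : A) (x y z : V), op b (op a x y) z = op a (op b x z) y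

/-- An isomorphism of multi-Novikov algebras: a linear bijection preserving every product. -/
structure MultiNovikovEquiv (K A V W : Type*) [Field K] [AddCommGroup V] [Module K V]
    [AddCommGroup W] [Module K W] [MultiNovikovAlgebra K A V] [MultiNovikovAlgebra K A W]
    extends V ≃ₗ[K] W where
  map_op : ∀ (a : A) (x y : V),
    toLinearEquiv (MultiNovikovAlgebra.op (K := K) a x y) =
      MultiNovikovAlgebra.op (K := K) a (toLinearEquiv x) (toLinearEquiv y)

/-! ### The free multi-Novikov algebra on a set -/

/-- Multi-magmatic monomials: binary trees with leaves labelled by `X` and internal vertices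
labelled by `A`. -/
inductive MultiMagma (A X : Type*) where
  | of : X → MultiMagma A X
  | op : A → MultiMagma A X → MultiMagma A X → MultiMagma A X

/-- The bilinear operation indexed by `a` on the free multi-magmatic algebra `MultiMagma A X →₀ K`,
extending the operation on monomials. -/
noncomputable def multiMagmaOp (K : Type*) {A X : Type*} [Field K] (a : A) :
    (MultiMagma A X →₀ K) →ₗ[K] (MultiMagma A X →₀ K) →ₗ[K] (MultiMagma A X →₀ K) :=
  Finsupp.linearCombination K fun s => Finsupp.lmapDomain K K (MultiMagma.op a s)

/-- A subspace of the free multi-magmatic algebra is a multi-Novikov ideal if it is a two-sided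
ideal for all the operations and contains all instances of the multi-Novikov identities. -/
structure IsMultiNovikovIdeal {K A X : Type*} [Field K]
    (I : Submodule K (MultiMagma A X →₀ K)) : Prop where
  op_left_mem : ∀ (a : A) (x y : MultiMagma A X →₀ K), x ∈ I → multiMagmaOp K a x y ∈ I
  op_right_mem : ∀ (a : A) (x y : MultiMagma A X →₀ K), y ∈ I → multiMagmaOp K a x y ∈ I
  exchange_args_mem : ∀ (a b : A) (x y z : MultiMagma A X →₀ K),
    (multiMagmaOp K b (multiMagmaOp K a x y) z - multiMagmaOp K a x (multiMagmaOp K b y z)) -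
      (multiMagmaOp K b (multiMagmaOp K a y x) z - multiMagmaOp K a y (multiMagmaOp K b x z)) ∈ I
  exchange_ops_mem : ∀ (a b : A) (x y z : MultiMagma A X →₀ K),
    (multiMagmaOp K b (multiMagmaOp K a x y) z - multiMagmaOp K a x (multiMagmaOp K b y z)) -
      (multiMagmaOp K a (multiMagmaOp K b x y) z - multiMagmaOp K b x (multiMagmaOp K a y z)) ∈ I
  right_comm_mem : ∀ (a b : A) (x y z : MultiMagma A X →₀ K),
    multiMagmaOp K b (multiMagmaOp K a x y) z - multiMagmaOp K a (multiMagmaOp K b x z) y ∈ I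

/-- The ideal generated by the multi-Novikov identities. -/
noncomputable def multiNovikovIdeal (K A X : Type*) [Field K] : Submodule K (MultiMagma A X →₀ K) :=
  sInf {I | IsMultiNovikovIdeal I}

theorem isMultiNovikovIdeal_multiNovikovIdeal (K A X : Type*) [Field K] :
    IsMultiNovikovIdeal (multiNovikovIdeal K A X) where
  op_left_mem a x y h := by
    simp only [multiNovikovIdeal, Submodule.mem_sInf, Set.mem_ofPred_eq] at h ⊢
    exact fun I hI => hI.op_left_mem a x y (h I hI)
  op_right_mem a x y h := by
    simp only [multiNovikovIdeal, Submodule.mem_sInf, Set.mem_ofPred_eq] at h ⊢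
    exact fun I hI => hI.op_right_mem a x y (h I hI)
  exchange_args_mem a b x y z := by
    simp only [multiNovikovIdeal, Submodule.mem_sInf, Set.mem_ofPred_eq]
    exact fun I hI => hI.exchange_args_mem a b x y z
  exchange_ops_mem a b x y z := by
    simp only [multiNovikovIdeal, Submodule.mem_sInf, Set.mem_ofPred_eq]
    exact fun I hI => hI.exchange_ops_mem a b x y z
  right_comm_mem a b x y z := by
    simp only [multiNovikovIdeal, Submodule.mem_sInf, Set.mem_ofPred_eq]
    exact fun I hI => hI.right_comm_mem a b x y z

/-- The free multi-Novikov algebra on the set `X`: the free multi-magmatic algebra modulo the ideal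
generated by the multi-Novikov identities. -/
abbrev FreeMultiNovikov (K A X : Type*) [Field K] : Type _ :=
  (MultiMagma A X →₀ K) ⧸ multiNovikovIdeal K A X

namespace FreeMultiNovikov

/-- The generators of the free multi-Novikov algebra. -/
noncomputable def of (K A : Type*) {X : Type*} [Field K] (x : X) : FreeMultiNovikov K A X :=
  (multiNovikovIdeal K A X).mkQ (Finsupp.single (MultiMagma.of x) 1)

/-- The product indexed by `a`, induced on the quotient. -/
noncomputable def op (K : Type*) {A X : Type*} [Field K] (a : A) :
    FreeMultiNovikov K A X →ₗ[K] FreeMultiNovikov K A X →ₗ[K] FreeMultiNovikov K A X :=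
  (multiNovikovIdeal K A X).liftQ
    (LinearMap.mk₂ K
      (fun x y => (multiNovikovIdeal K A X).liftQ
        ((multiNovikovIdeal K A X).mkQ ∘ₗ multiMagmaOp K a x)
        (fun v hv => by
          simpa using (isMultiNovikovIdeal_multiNovikovIdeal K A X).op_right_mem a x v hv) y)
      (fun x x' y => by
        obtain ⟨y, rfl⟩ := Submodule.mkQ_surjective _ y
        simp)
      (fun c x y => by
        obtain ⟨y, rfl⟩ := Submodule.mkQ_surjective _ y
        simp)
      (fun x y y' => by simp)
      (fun c x y => by simp))
    (fun x hx => by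
      rw [LinearMap.mem_ker]
      refine LinearMap.ext fun y => ?_
      obtain ⟨y, rfl⟩ := Submodule.mkQ_surjective _ y
      simpa using (isMultiNovikovIdeal_multiNovikovIdeal K A X).op_left_mem a x y hx)

theorem op_mkQ (K : Type*) {A X : Type*} [Field K] (a : A) (x y : MultiMagma A X →₀ K) :
    op K a ((multiNovikovIdeal K A X).mkQ x) ((multiNovikovIdeal K A X).mkQ y) =
      (multiNovikovIdeal K A X).mkQ (multiMagmaOp K a x y) := by
  simp [op]

noncomputable instance (K A X : Type*) [Field K] :
    MultiNovikovAlgebra K A (FreeMultiNovikov K A X) where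
  op := op K
  exchange_args a b x y z := by
    obtain ⟨x, rfl⟩ := Submodule.mkQ_surjective _ x
    obtain ⟨y, rfl⟩ := Submodule.mkQ_surjective _ y
    obtain ⟨z, rfl⟩ := Submodule.mkQ_surjective _ z
    simp only [op_mkQ, ← map_sub]
    exact (Submodule.Quotient.eq _).2
      ((isMultiNovikovIdeal_multiNovikovIdeal K A X).exchange_args_mem a b x y z)
  exchange_ops a b x y z := by
    obtain ⟨x, rfl⟩ := Submodule.mkQ_surjective _ x
    obtain ⟨y, rfl⟩ := Submodule.mkQ_surjective _ y
    obtain ⟨z, rfl⟩ := Submodule.mkQ_surjective _ z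
    simp only [op_mkQ, ← map_sub]
    exact (Submodule.Quotient.eq _).2
      ((isMultiNovikovIdeal_multiNovikovIdeal K A X).exchange_ops_mem a b x y z)
  right_comm a b x y z := by
    obtain ⟨x, rfl⟩ := Submodule.mkQ_surjective _ x
    obtain ⟨y, rfl⟩ := Submodule.mkQ_surjective _ y
    obtain ⟨z, rfl⟩ := Submodule.mkQ_surjective _ z
    simp only [op_mkQ]
    exact (Submodule.Quotient.eq _).2
      ((isMultiNovikovIdeal_multiNovikovIdeal K A X).right_comm_mem a b x y z)

/-- The extension of a map on generators to multi-magmatic monomials. -/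
noncomputable def magmaLift (K : Type*) {A X V : Type*} [Field K] [AddCommGroup V] [Module K V]
    [MultiNovikovAlgebra K A V] (f : X → V) : MultiMagma A X → V
  | .of x => f x
  | .op a s t => MultiNovikovAlgebra.op (K := K) a (magmaLift K f s) (magmaLift K f t)

/-- The universal property of the free multi-Novikov algebra. -/
theorem existsUnique_lift (K : Type*) {A X V : Type*} [Field K] [AddCommGroup V] [Module K V]
    [MultiNovikovAlgebra K A V] (f : X → V) :
    ∃! φ : FreeMultiNovikov K A X →ₗ[K] V,
      (∀ (a : A) (x y : FreeMultiNovikov K A X),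
        φ (MultiNovikovAlgebra.op (K := K) a x y) =
          MultiNovikovAlgebra.op (K := K) a (φ x) (φ y)) ∧
      ∀ x, φ (of K A x) = f x := by
  have hop : ∀ (G : (MultiMagma A X →₀ K) →ₗ[K] V),
      (∀ a s t, G (Finsupp.single (.op a s t) 1) = MultiNovikovAlgebra.op (K := K) a
        (G (Finsupp.single s 1)) (G (Finsupp.single t 1))) → ∀ a x y, G (multiMagmaOp K a x y) =
        MultiNovikovAlgebra.op (K := K) a (G x) (G y) := by
    intro G hG a x y
    induction x using Finsupp.induction_linear with
    | zero => simp
    | add x x' h h' => simp [h, h']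
    | single s c =>
      induction y using Finsupp.induction_linear with
      | zero => simp
      | add y y' h h' => simp only [map_add, h, h']
      | single t e =>
        have h1 : ∀ (s : MultiMagma A X) (c : K),
            Finsupp.single s c = c • Finsupp.single s 1 := by simp
        rw [h1 s c, h1 t e]
        simp only [map_smul, LinearMap.smul_apply]
        rw [← hG]
        simp [multiMagmaOp]
  let G : (MultiMagma A X →₀ K) →ₗ[K] V := Finsupp.linearCombination K (magmaLift K f)
  have hG := hop G (by simp [G, magmaLift])
  have hI : multiNovikovIdeal K A X ≤ LinearMap.ker G := by
    refine sInf_le ?_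
    constructor
    · intro a x y h
      rw [LinearMap.mem_ker] at h ⊢
      simp [hG, h]
    · intro a x y h
      rw [LinearMap.mem_ker] at h ⊢
      simp [hG, h]
    · intro a b x y z
      simp only [LinearMap.mem_ker, map_sub, hG]
      exact sub_eq_zero.2 (MultiNovikovAlgebra.exchange_args a b _ _ _)
    · intro a b x y z
      simp only [LinearMap.mem_ker, map_sub, hG]
      exact sub_eq_zero.2 (MultiNovikovAlgebra.exchange_ops a b _ _ _)
    · intro a b x y z
      simp only [LinearMap.mem_ker, map_sub, hG]
      exact sub_eq_zero.2 (MultiNovikovAlgebra.right_comm a b _ _ _)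
  refine ⟨(multiNovikovIdeal K A X).liftQ G hI, ⟨fun a x y => ?_, fun x => ?_⟩, ?_⟩
  · obtain ⟨x, rfl⟩ := Submodule.mkQ_surjective _ x
    obtain ⟨y, rfl⟩ := Submodule.mkQ_surjective _ y
    change (multiNovikovIdeal K A X).liftQ G hI (op K a _ _) = _
    rw [op_mkQ]
    simpa using hG a x y
  · simp [of, G, magmaLift]
  · rintro ψ ⟨hψ, hψ'⟩
    refine Submodule.linearMap_qext _ (Finsupp.lhom_ext' fun s => LinearMap.ext_ring ?_)
    induction s with
    | of x => simpa [G, magmaLift, of] using hψ' x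
    | op a s t hs ht =>
      have h : (Finsupp.single (MultiMagma.op a s t) 1 : MultiMagma A X →₀ K) =
          multiMagmaOp K a (Finsupp.single s 1) (Finsupp.single t 1) := by
        simp [multiMagmaOp]
      simp only [LinearMap.comp_apply, Finsupp.lsingle_apply, Submodule.liftQ_mkQ] at hs ht ⊢
      rw [h, hG, ← op_mkQ]
      refine (hψ a _ _).trans ?_
      rw [hs, ht]

end FreeMultiNovikov

/-! ### The word algebra -/

/-- The letters of the word algebra: `jet n` is the letter `n ∈ ℕ^{d+1}` (standing for the
derivative with respect to `u^{(n)}`), and `der i` is the letter `d_i`, `0 ≤ i ≤ d`. -/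
inductive SPDELetter (d : ℕ) where
  | jet : (Fin (d + 1) → ℕ) → SPDELetter d
  | der : Fin (d + 1) → SPDELetter d

/-- The defining relations `d_i d_j = d_j d_i`, `n n' = n' n`, `d_i n = n_i (n - e_i) + n d_i`.
When `n i = 0` the subtraction is truncated, but then the coefficient vanishes. -/
inductive SPDEWordRel (K : Type*) [Field K] (d : ℕ) :
    FreeAlgebra K (SPDELetter d) → FreeAlgebra K (SPDELetter d) → Prop where
  | der_der (i j : Fin (d + 1)) : SPDEWordRel K d
      (FreeAlgebra.ι K (.der i) * FreeAlgebra.ι K (.der j))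
      (FreeAlgebra.ι K (.der j) * FreeAlgebra.ι K (.der i))
  | jet_jet (n n' : Fin (d + 1) → ℕ) : SPDEWordRel K d
      (FreeAlgebra.ι K (.jet n) * FreeAlgebra.ι K (.jet n'))
      (FreeAlgebra.ι K (.jet n') * FreeAlgebra.ι K (.jet n))
  | der_jet (i : Fin (d + 1)) (n : Fin (d + 1) → ℕ) : SPDEWordRel K d
      (FreeAlgebra.ι K (.der i) * FreeAlgebra.ι K (.jet n))
      ((n i : K) • FreeAlgebra.ι K (.jet (n - Pi.single i 1)) +
        FreeAlgebra.ι K (.jet n) * FreeAlgebra.ι K (.der i))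

/-- The unital associative algebra generated by the letters `n` and `d_i` subject to the above
relations. -/
abbrev SPDEWordAlgebra (K : Type*) [Field K] (d : ℕ) : Type _ := RingQuot (SPDEWordRel K d)

namespace SPDEWordAlgebra

/-- The image of a letter in the word algebra. -/
noncomputable def letter (K : Type*) [Field K] {d : ℕ} (c : SPDELetter d) : SPDEWordAlgebra K d :=
  RingQuot.mkAlgHom K (SPDEWordRel K d) (FreeAlgebra.ι K c)

/-- The element of the word algebra represented by a word. -/
noncomputable def word (K : Type*) [Field K] {d : ℕ} (w : List (SPDELetter d)) :
    SPDEWordAlgebra K d :=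
  (w.map (letter K)).prod

/-- The element `d_0^{k_0} d_1^{k_1} ⋯ d_d^{k_d}` (the `d_i` commute). -/
noncomputable def derPow (K : Type*) [Field K] {d : ℕ} (k : Fin (d + 1) → ℕ) :
    SPDEWordAlgebra K d :=
  (List.ofFn fun i => letter K (.der i) ^ k i).prod

theorem letter_der_der (K : Type*) [Field K] {d : ℕ} (i j : Fin (d + 1)) :
    letter K (.der i) * letter K (.der j) = letter K (.der j) * letter K (.der i) := by
  simpa [letter] using RingQuot.mkAlgHom_rel K (SPDEWordRel.der_der (K := K) i j)

theorem letter_jet_jet (K : Type*) [Field K] {d : ℕ} (n n' : Fin (d + 1) → ℕ) :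
    letter K (.jet n) * letter K (.jet n') = letter K (.jet n') * letter K (.jet n) := by
  simpa [letter] using RingQuot.mkAlgHom_rel K (SPDEWordRel.jet_jet (K := K) n n')

theorem letter_der_jet (K : Type*) [Field K] {d : ℕ} (i : Fin (d + 1)) (n : Fin (d + 1) → ℕ) :
    letter K (.der i) * letter K (.jet n) =
      (n i : K) • letter K (.jet (n - Pi.single i 1)) + letter K (.jet n) * letter K (.der i) := by
  simpa only [letter, map_mul, map_add, map_smul] using
    RingQuot.mkAlgHom_rel K (SPDEWordRel.der_jet (K := K) i n)

end SPDEWordAlgebra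

/-- The number `|w|` of letters `n ∈ ℕ^{d+1}` in a word `w`. -/
def SPDELetter.jetLength {d : ℕ} : List (SPDELetter d) → ℕ
  | [] => 0
  | .jet _ :: w => jetLength w + 1
  | .der _ :: w => jetLength w

/-! ### SPDE multi-indices -/

/-- The algebra of SPDE multi-indices: the commutative polynomial algebra in the variables
`z_{(l,α)}`, `l ∈ L`, `α` in the word algebra, modulo linearity of `z_{(l,α)}` in `α`; that is, the
symmetric algebra on the direct sum over `l ∈ L` of copies of the word algebra. -/
abbrev SPDEMultiIndexAlgebra (K : Type*) [Field K] (d : ℕ) (L : Type*) : Type _ :=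
  SymmetricAlgebra K (L →₀ SPDEWordAlgebra K d)

/-- The derivation of a symmetric algebra extending a linear endomorphism of its generators. -/
noncomputable def symmetricAlgebraDerivation {K M : Type*} [Field K] [AddCommMonoid M] [Module K M]
    (f : M →ₗ[K] M) : Derivation K (SymmetricAlgebra K M) (SymmetricAlgebra K M) :=
  let F : SymmetricAlgebra K M →ₐ[K] TrivSqZeroExt (SymmetricAlgebra K M) (SymmetricAlgebra K M) :=
    SymmetricAlgebra.lift
      ((TrivSqZeroExt.inlAlgHom K (SymmetricAlgebra K M) (SymmetricAlgebra K M)).toLinearMap ∘ₗ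
          SymmetricAlgebra.ι K M +
        (TrivSqZeroExt.inrHom (SymmetricAlgebra K M) (SymmetricAlgebra K M)).restrictScalars K ∘ₗ
          SymmetricAlgebra.ι K M ∘ₗ f)
  have hF : ∀ x, (F x).fst = x := fun x => by
    have h : (TrivSqZeroExt.fstHom K (SymmetricAlgebra K M) (SymmetricAlgebra K M)).comp F =
        AlgHom.id K _ := by
      apply SymmetricAlgebra.algHom_ext
      ext m
      simp [F]
    exact congrArg (fun g => g x) h
  Derivation.mk' ((TrivSqZeroExt.sndHom (SymmetricAlgebra K M)
      (SymmetricAlgebra K M)).restrictScalars K ∘ₗ F.toLinearMap) (fun x y => by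
    simp [hF, mul_comm])

theorem symmetricAlgebraDerivation_ι {K M : Type*} [Field K] [AddCommMonoid M] [Module K M]
    (f : M →ₗ[K] M) (m : M) :
    symmetricAlgebraDerivation f (SymmetricAlgebra.ι K M m) = SymmetricAlgebra.ι K M (f m) := by
  simp [symmetricAlgebraDerivation]

theorem symmetricAlgebra_derivation_ext {K M : Type*} [Field K] [AddCommMonoid M] [Module K M]
    {D E : Derivation K (SymmetricAlgebra K M) (SymmetricAlgebra K M)}
    (h : ∀ m, D (SymmetricAlgebra.ι K M m) = E (SymmetricAlgebra.ι K M m)) : D = E := by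
  ext x
  induction x using SymmetricAlgebra.induction with
  | algebraMap r => simp
  | ι x => exact h x
  | mul a b ha hb => simp [ha, hb]
  | add a b ha hb => simp [ha, hb]

namespace SPDEMultiIndexAlgebra

open SPDEWordAlgebra

/-- The variable `z_{(l,α)}`, linear in `α`. -/
noncomputable def z {K : Type*} [Field K] {d : ℕ} {L : Type*} (l : L) :
    SPDEWordAlgebra K d →ₗ[K] SPDEMultiIndexAlgebra K d L :=
  SymmetricAlgebra.ι K (L →₀ SPDEWordAlgebra K d) ∘ₗ Finsupp.lsingle l

/-- The unique derivation sending every variable `z_{(l,α)}` to `z_{(l,cα)}`, for a letter `c`. -/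
noncomputable def letterDerivation (K : Type*) [Field K] {d : ℕ} (L : Type*) (c : SPDELetter d) :
    Derivation K (SPDEMultiIndexAlgebra K d L) (SPDEMultiIndexAlgebra K d L) :=
  symmetricAlgebraDerivation (Finsupp.mapRange.linearMap (LinearMap.mulLeft K (letter K c)))

/-- The derivation `D^{(n)}`, sending `z_{(l,α)}` to `z_{(l,nα)}`. -/
noncomputable abbrev D (K : Type*) [Field K] {d : ℕ} (L : Type*) (n : Fin (d + 1) → ℕ) :
    Derivation K (SPDEMultiIndexAlgebra K d L) (SPDEMultiIndexAlgebra K d L) :=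
  letterDerivation K L (.jet n)

/-- The derivation `∂_i`, sending `z_{(l,α)}` to `z_{(l,d_i α)}`. -/
noncomputable abbrev pd (K : Type*) [Field K] {d : ℕ} (L : Type*) (i : Fin (d + 1)) :
    Derivation K (SPDEMultiIndexAlgebra K d L) (SPDEMultiIndexAlgebra K d L) :=
  letterDerivation K L (.der i)

theorem letterDerivation_z (K : Type*) [Field K] {d : ℕ} {L : Type*} (c : SPDELetter d) (l : L)
    (α : SPDEWordAlgebra K d) : letterDerivation K L c (z l α) = z l (letter K c * α) := by
  simp [letterDerivation, z, symmetricAlgebraDerivation_ι]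

theorem derivation_ext {K : Type*} [Field K] {d : ℕ} {L : Type*}
    {E E' : Derivation K (SPDEMultiIndexAlgebra K d L) (SPDEMultiIndexAlgebra K d L)}
    (h : ∀ l α, E (z l α) = E' (z l α)) : E = E' := by
  apply symmetricAlgebra_derivation_ext
  intro m
  induction m using Finsupp.induction_linear with
  | zero => simp
  | add f g hf hg => simp [hf, hg]
  | single l α => exact h l α

theorem D_comm (K : Type*) [Field K] {d : ℕ} (L : Type*) (n n' : Fin (d + 1) → ℕ)
    (x : SPDEMultiIndexAlgebra K d L) : D K L n (D K L n' x) = D K L n' (D K L n x) := by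
  have h : ⁅D K L n, D K L n'⁆ = 0 := derivation_ext fun l α => by
    simp only [Derivation.commutator_apply, letterDerivation_z, ← mul_assoc,
      letter_jet_jet K n n', sub_self, Derivation.zero_apply]
  exact sub_eq_zero.1 (by rw [← Derivation.commutator_apply, h, Derivation.zero_apply])

theorem pd_comm (K : Type*) [Field K] {d : ℕ} (L : Type*) (i j : Fin (d + 1))
    (x : SPDEMultiIndexAlgebra K d L) : pd K L i (pd K L j x) = pd K L j (pd K L i x) := by
  have h : ⁅pd K L i, pd K L j⁆ = 0 := derivation_ext fun l α => by
    simp only [Derivation.commutator_apply, letterDerivation_z, ← mul_assoc,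
      letter_der_der K i j, sub_self, Derivation.zero_apply]
  exact sub_eq_zero.1 (by rw [← Derivation.commutator_apply, h, Derivation.zero_apply])

/-- The relation `∂_i D^{(n)} = D^{(n)} ∂_i + n_i D^{(n - e_i)}`. -/
theorem pd_D (K : Type*) [Field K] {d : ℕ} (L : Type*) (i : Fin (d + 1)) (n : Fin (d + 1) → ℕ)
    (x : SPDEMultiIndexAlgebra K d L) :
    pd K L i (D K L n x) = D K L n (pd K L i x) + (n i : K) • D K L (n - Pi.single i 1) x := by
  have h : ⁅pd K L i, D K L n⁆ = (n i : K) • D K L (n - Pi.single i 1) :=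
    derivation_ext fun l α => by
      simp only [Derivation.commutator_apply, letterDerivation_z, ← mul_assoc,
        letter_der_jet K i n, add_mul, smul_mul_assoc, map_add, map_smul, add_sub_cancel_right,
        Derivation.smul_apply]
  rw [← sub_eq_iff_eq_add', ← Derivation.commutator_apply, h, Derivation.smul_apply]

/-- The monomial `z^β`, the product of the `z_{(l,w)}^{β(l,w)}`, for a multi-index `β`, that is, a
finitely supported map from pairs `(l,w)` with `w` a word to `ℕ`. -/
noncomputable def monomial (K : Type*) [Field K] {d : ℕ} {L : Type*}
    (β : L × List (SPDELetter d) →₀ ℕ) : SPDEMultiIndexAlgebra K d L :=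
  β.prod fun p e => z p.1 (word K p.2) ^ e

/-- The quantity `∑ (1 - |w|) β(l,w)`. -/
noncomputable def weight {d : ℕ} {L : Type*} (β : L × List (SPDELetter d) →₀ ℕ) : ℤ :=
  β.sum fun p e => (1 - (SPDELetter.jetLength p.2 : ℤ)) * e

/-- The span of all monomials `z^β` with `∑ (1 - |w|) β(l,w) = m`. -/
noncomputable def weightSpan (K : Type*) [Field K] (d : ℕ) (L : Type*) (m : ℤ) :
    Submodule K (SPDEMultiIndexAlgebra K d L) :=
  Submodule.span K {x | ∃ β : L × List (SPDELetter d) →₀ ℕ, weight β = m ∧ monomial K β = x}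

/-- A multi-index `β` is populated if `∑ (1 - |w|) β(l,w) = 1`; this is the span of the populated
multi-indices. -/
noncomputable abbrev populated (K : Type*) [Field K] (d : ℕ) (L : Type*) :
    Submodule K (SPDEMultiIndexAlgebra K d L) :=
  weightSpan K d L 1

theorem weight_add {d : ℕ} {L : Type*} (β γ : L × List (SPDELetter d) →₀ ℕ) :
    weight (β + γ) = weight β + weight γ := by
  classical
  exact Finsupp.sum_add_index' (by simp) (by intros; push_cast; ring)

theorem monomial_add (K : Type*) [Field K] {d : ℕ} {L : Type*}
    (β γ : L × List (SPDELetter d) →₀ ℕ) :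
    monomial K (β + γ) = monomial K β * monomial K γ := by
  classical
  exact Finsupp.prod_add_index' (by simp) (by intros; rw [pow_add])

theorem monomial_mem {K : Type*} [Field K] {d : ℕ} {L : Type*}
    (β : L × List (SPDELetter d) →₀ ℕ) : monomial K β ∈ weightSpan K d L (weight β) :=
  Submodule.subset_span ⟨β, rfl, rfl⟩

theorem mul_mem {K : Type*} [Field K] {d : ℕ} {L : Type*} {m m' : ℤ}
    {x y : SPDEMultiIndexAlgebra K d L} (hx : x ∈ weightSpan K d L m)
    (hy : y ∈ weightSpan K d L m') : x * y ∈ weightSpan K d L (m + m') := by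
  refine Submodule.span_induction₂ (p := fun x y _ _ => x * y ∈ weightSpan K d L (m + m'))
    ?_ (by simp) (by simp) ?_ ?_ ?_ ?_ hx hy
  · rintro _ _ ⟨β, rfl, rfl⟩ ⟨γ, rfl, rfl⟩
    rw [← monomial_add, ← weight_add]
    exact monomial_mem _
  · intro x y z _ _ _ h h'
    rw [add_mul]
    exact add_mem h h'
  · intro x y z _ _ _ h h'
    rw [mul_add]
    exact add_mem h h'
  · intro r x y _ _ h
    rw [smul_mul_assoc]
    exact Submodule.smul_mem _ _ h
  · intro r x y _ _ h
    rw [mul_smul_comm]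
    exact Submodule.smul_mem _ _ h

theorem D_monomial_mem {K : Type*} [Field K] {d : ℕ} {L : Type*} (n : Fin (d + 1) → ℕ)
    (β : L × List (SPDELetter d) →₀ ℕ) :
    D K L n (monomial K β) ∈ weightSpan K d L (weight β - 1) := by
  have hadd : ∀ β γ : L × List (SPDELetter d) →₀ ℕ,
      D K L n (monomial K β) ∈ weightSpan K d L (weight β - 1) →
      D K L n (monomial K γ) ∈ weightSpan K d L (weight γ - 1) →
      D K L n (monomial K (β + γ)) ∈ weightSpan K d L (weight (β + γ) - 1) := by
    intro β γ hβ hγ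
    rw [monomial_add, weight_add, Derivation.leibniz, smul_eq_mul, smul_eq_mul]
    refine add_mem ?_ ?_
    · have := mul_mem (monomial_mem (K := K) β) hγ
      rwa [← add_sub_assoc] at this
    · have := mul_mem (monomial_mem (K := K) γ) hβ
      rwa [← add_sub_assoc, add_comm] at this
  have hzero : D K L n (monomial K (0 : L × List (SPDELetter d) →₀ ℕ)) ∈
      weightSpan K d L (weight (0 : L × List (SPDELetter d) →₀ ℕ) - 1) := by
    simp [monomial]
  induction β using Finsupp.induction_linear with
  | zero => exact hzero
  | add β γ hβ hγ => exact hadd β γ hβ hγ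
  | single p e =>
    induction e with
    | zero => rw [Finsupp.single_zero]; exact hzero
    | succ e ih =>
      rw [Finsupp.single_add]
      refine hadd _ _ ih ?_
      have h : D K L n (monomial K (Finsupp.single p 1)) =
          monomial K (Finsupp.single (p.1, SPDELetter.jet n :: p.2) 1) := by
        simp [monomial, letterDerivation_z, word]
      have h' : weight (Finsupp.single p 1) - 1 =
          weight (Finsupp.single (p.1, SPDELetter.jet n :: p.2) 1) := by
        simp [weight, SPDELetter.jetLength]
      rw [h, h']
      exact monomial_mem _

theorem D_mem {K : Type*} [Field K] {d : ℕ} {L : Type*} (n : Fin (d + 1) → ℕ) {m : ℤ}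
    {x : SPDEMultiIndexAlgebra K d L} (hx : x ∈ weightSpan K d L m) :
    D K L n x ∈ weightSpan K d L (m - 1) := by
  induction hx using Submodule.span_induction with
  | mem x h =>
    obtain ⟨β, rfl, rfl⟩ := h
    exact D_monomial_mem n β
  | zero => simp
  | add x y _ _ hx hy => rw [map_add]; exact add_mem hx hy
  | smul r x _ hx => rw [Derivation.map_smul]; exact Submodule.smul_mem _ _ hx

/-- The multi-Novikov algebra of populated SPDE multi-indices, with the products
`x ▷ₙ y = x * D^{(n)} y`, `n ∈ ℕ^{d+1}`. -/
noncomputable instance (K : Type*) [Field K] (d : ℕ) (L : Type*) :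
    MultiNovikovAlgebra K (Fin (d + 1) → ℕ) (populated K d L) where
  op n := LinearMap.mk₂ K
    (fun x y => ⟨(x : SPDEMultiIndexAlgebra K d L) * D K L n y, by
      simpa using mul_mem x.2 (D_mem n y.2)⟩)
    (fun x x' y => Subtype.ext (by simp [add_mul]))
    (fun c x y => Subtype.ext (by simp))
    (fun x y y' => Subtype.ext (by simp [mul_add]))
    (fun c x y => Subtype.ext (by simp))
  exchange_args a b x y z := Subtype.ext (by simp; ring)
  exchange_ops a b x y z := Subtype.ext (by simp [D_comm K L a b]; ring)
  right_comm a b x y z := Subtype.ext (by simp; ring)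

theorem coe_op {K : Type*} [Field K] {d : ℕ} {L : Type*} (n : Fin (d + 1) → ℕ)
    (x y : populated K d L) :
    (MultiNovikovAlgebra.op (K := K) n x y : SPDEMultiIndexAlgebra K d L) =
      (x : SPDEMultiIndexAlgebra K d L) * D K L n y := rfl

end SPDEMultiIndexAlgebra

/-! Moving every `d_i` to the right gives the word algebra the basis `n₁ ⋯ n_r d^k` (`normalBasis`).
So the multi-indices form a polynomial algebra in variables `(x, w)`, with `x = (k, l)` a generator
and `w` a multiset of letters, and `D^{(n)}` adds `n` to `w`. This is the free commutative algebra
on the `x` with commuting derivations. The rewriting preserves `r`, so populated elements become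
polynomials of weight one when `(x, w)` has weight `1 - |w|` (`polyEquiv_mem`). It remains to invert
the canonical map from the free multi-Novikov algebra.

The inverse needs a value for each weight-one monomial in an arbitrary multi-Novikov algebra `V`,
where no commutative product is available. A factor `(x, w)` with `|w| = k ≥ 1` is therefore
replaced by a `k`-ary operation standing for `v₁ ⋯ vₖ D^w f(x)`. It is built by reading the Leibniz
rule backwards: `v (D_a q) ∏ xᵢ` is `v ▷ₐ (q ∏ xᵢ)` minus the terms in which one `xᵢ` becomes `v ▷ₐ
xᵢ`. The two exchange identities make these operations symmetric and independent of the order of the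
derivatives (`listJet_isNovikovOp_and_comm`). Right commutativity makes them commute with right
multiplications, hence with one another (`interchange_jetOp`).

Composites of such operations thus depend only on the multiset of factors (`contraction_perm`).
Weight one says precisely that the leaves `(x, 0)` are as many as the arity of the composite, so
feeding them in gives a value, `monomialValue`. A Leibniz rule for composites
(`derivOp_contraction`) shows that these values respect the products (`polyValue_mul_polyDeriv`).

One composite of the two maps is the identity by uniqueness in the universal property. For the
other, a homomorphism into a commutative differential algebra turns each operation into genuine
multiplication by its factor, so every monomial is returned unchanged (`map_polyValue`). -/

/-! ### Symmetric multilinear operations on a multi-Novikov algebra -/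

namespace MultiNovikovAlgebra

section Operations

variable {K A V : Type*} [Field K] [AddCommGroup V] [Module K V]

/-- The natural action of an endomorphism `T` of `V` on operations `V^k → V`, `k ≥ 0`, encoded as
functions on lists: `T (h L) - ∑ i, h (L with its i-th entry x replaced by T x)`. -/
def endAct (T : V →ₗ[K] V) : (List V → V) → List V → V
  | h, [] => T (h [])
  | h, v :: L => endAct T (fun M => h (v :: M)) L - h (T v :: L)

theorem endAct_zero (T : V →ₗ[K] V) (L : List V) : endAct T (fun _ => 0) L = 0 := by
  induction L with
  | nil => simp [endAct]
  | cons v L ih => simp [endAct, ih]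

theorem endAct_sub (T : V →ₗ[K] V) (h h' : List V → V) (L : List V) :
    endAct T (fun M => h M - h' M) L = endAct T h L - endAct T h' L := by
  induction L generalizing h h' with
  | nil => simp [endAct]
  | cons v L ih => simp only [endAct, ih]; abel

/-- Symmetric multilinear operations. -/
structure IsSymmMultilinear (K : Type*) {V : Type*} [Field K] [AddCommGroup V] [Module K V]
    (h : List V → V) : Prop where
  perm : ∀ {L L' : List V}, L.Perm L' → h L = h L'
  add : ∀ (u v : V) (L : List V), h ((u + v) :: L) = h (u :: L) + h (v :: L)
  smul : ∀ (r : K) (v : V) (L : List V), h ((r • v) :: L) = r • h (v :: L)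

namespace IsSymmMultilinear

variable {h : List V → V}

theorem sub (H : IsSymmMultilinear K h) (u v : V) (L : List V) :
    h ((u - v) :: L) = h (u :: L) - h (v :: L) := by
  have := H.add (u - v) v L
  rw [sub_add_cancel] at this
  rw [this, add_sub_cancel_right]

theorem zero (H : IsSymmMultilinear K h) (L : List V) : h (0 :: L) = 0 := by
  simpa using H.sub 0 0 L

theorem tail (H : IsSymmMultilinear K h) (v : V) : IsSymmMultilinear K fun M => h (v :: M) where
  perm p := H.perm (p.cons v)
  add u w L := by
    rw [H.perm (.swap _ _ _), H.add, H.perm (.swap v u L), H.perm (.swap v w L)]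
  smul r w L := by
    rw [H.perm (.swap _ _ _), H.smul, H.perm (.swap v w L)]

end IsSymmMultilinear

theorem endAct_add_left (T T' : V →ₗ[K] V) {h : List V → V} (H : IsSymmMultilinear K h)
    (L : List V) : endAct (T + T') h L = endAct T h L + endAct T' h L := by
  induction L generalizing h with
  | nil => simp [endAct]
  | cons v L ih => simp only [endAct, ih (H.tail v), LinearMap.add_apply, H.add]; abel

theorem endAct_sub_left (T T' : V →ₗ[K] V) {h : List V → V} (H : IsSymmMultilinear K h)
    (L : List V) : endAct (T - T') h L = endAct T h L - endAct T' h L := by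
  induction L generalizing h with
  | nil => simp [endAct]
  | cons v L ih => simp only [endAct, ih (H.tail v), LinearMap.sub_apply, H.sub]; abel

theorem endAct_smul_left (r : K) (T : V →ₗ[K] V) {h : List V → V} (H : IsSymmMultilinear K h)
    (L : List V) : endAct (r • T) h L = r • endAct T h L := by
  induction L generalizing h with
  | nil => simp [endAct]
  | cons v L ih => simp only [endAct, ih (H.tail v), LinearMap.smul_apply, H.smul, smul_sub]

/-- This is the Lie action of endomorphisms on multilinear operations: contributions of `T` and `T'`
at different places cancel, and those at the same entry combine by linearity in that entry. -/
theorem endAct_commutator (T T' : V →ₗ[K] V) {h : List V → V} (H : IsSymmMultilinear K h)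
    (L : List V) :
    endAct T (endAct T' h) L - endAct T' (endAct T h) L = endAct (T ∘ₗ T' - T' ∘ₗ T) h L := by
  induction L generalizing h with
  | nil => simp [endAct]
  | cons v L ih =>
    simp only [endAct, endAct_sub, LinearMap.sub_apply, LinearMap.comp_apply, H.sub,
      ← ih (H.tail v)]
    abel

theorem endAct_perm (T : V →ₗ[K] V) {h : List V → V} (H : IsSymmMultilinear K h)
    {L L' : List V} (p : L.Perm L') : endAct T h L = endAct T h L' := by
  induction p generalizing h with
  | nil => rfl
  | cons x p ih =>
    simp only [endAct]
    rw [ih (H.tail x), H.perm (p.cons _)]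
  | swap x y l =>
    simp only [endAct]
    have : (fun M => h (y :: x :: M)) = fun M => h (x :: y :: M) :=
      funext fun M => H.perm (.swap _ _ _)
    rw [this, H.perm (.swap x (T y) l), H.perm (.swap (T x) y l)]
    abel
  | trans _ _ ih ih' => exact (ih H).trans (ih' H)

/-- The operation without arguments with value `y`. -/
def constOp (y : V) : List V → V
  | [] => y
  | _ :: _ => 0

theorem endAct_constOp (T : V →ₗ[K] V) (y : V) (L : List V) :
    endAct T (constOp y) L = constOp (T y) L := by
  cases L with
  | nil => rfl
  | cons v L => simpa [endAct, constOp] using endAct_zero T L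

variable [MultiNovikovAlgebra K A V]

/-- The derivative of an operation `h`: if `h` is multiplication by `q` in a commutative algebra
with derivations `D a`, then `derivOp K a h` is multiplication by `D a q`. -/
def derivOp (K : Type*) {A V : Type*} [Field K] [AddCommGroup V] [Module K V]
    [MultiNovikovAlgebra K A V] (a : A) (h : List V → V) : List V → V
  | [] => 0
  | v :: L => endAct (op (K := K) a v) h L

/-- Operations compatible with all right multiplications. -/
structure IsNovikovOp (K A : Type*) {V : Type*} [Field K] [AddCommGroup V] [Module K V]
    [MultiNovikovAlgebra K A V] (h : List V → V) : Prop extends IsSymmMultilinear K h where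
  op_right : ∀ (a : A) (v y : V) (L : List V),
    h (op (K := K) a v y :: L) = op (K := K) a (h (v :: L)) y

/-- The two exchange identities, used one after the other, say that the associator is unchanged when
`(a, u)` and `(b, v)` trade places together. -/
theorem op_commutator (a b : A) (u v : V) :
    (op (K := K) a u ∘ₗ op (K := K) b v - op (K := K) b v ∘ₗ op (K := K) a u : V →ₗ[K] V) =
      op (K := K) b (op (K := K) a u v) - op (K := K) a (op (K := K) b v u) := by
  ext z
  have h := (exchange_args (K := K) a b u v z).trans (exchange_ops a b v u z)
  simp only [LinearMap.sub_apply, LinearMap.comp_apply]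
  rw [sub_eq_sub_iff_add_eq_add] at h ⊢
  rw [add_comm, ← h, add_comm]

/-- Unfolding both sides leaves the commutator of the actions of `u ▷ₐ ·` and `v ▷_b ·`, corrected
by exactly the two terms of `op_commutator`. Consequently, symmetry in the arguments and commutation
of the derivatives can be traded for one another. -/
theorem derivOp_derivOp_cons_cons (a b : A) {h : List V → V} (H : IsSymmMultilinear K h)
    (u v : V) (L : List V) :
    derivOp K a (derivOp K b h) (u :: v :: L) = derivOp K b (derivOp K a h) (v :: u :: L) := by
  have h1 := endAct_commutator (op (K := K) a u) (op (K := K) b v) H L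
  rw [op_commutator, endAct_sub_left _ _ H] at h1
  simp only [derivOp, endAct]
  rw [sub_eq_sub_iff_sub_eq_sub]
  exact h1

/-- Symmetry in all arguments but the first is inherited from `h`, so the first transposition is all
that is missing. Compatibility with right multiplications comes from `(v ▷_b y) ▷ₐ z = (v ▷ₐ z) ▷_b
y`, applied to the value of `h` and to each of its entries. -/
theorem isNovikovOp_derivOp_of_swap (a : A) {h : List V → V} (H : IsNovikovOp K A h)
    (hswap : ∀ u v L, derivOp K a h (u :: v :: L) = derivOp K a h (v :: u :: L)) :
    IsNovikovOp K A (derivOp K a h) where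
  perm {L L'} p := by
    induction p with
    | nil => rfl
    | cons x p _ => exact endAct_perm _ H.toIsSymmMultilinear p
    | swap x y l => exact hswap _ _ _
    | trans _ _ ih ih' => exact ih.trans ih'
  add u v L := by
    simp only [derivOp, map_add, endAct_add_left _ _ H.toIsSymmMultilinear]
  smul r v L := by
    simp only [derivOp, map_smul, endAct_smul_left _ _ H.toIsSymmMultilinear]
  op_right b v y L := by
    have key : ∀ {g : List V → V}, IsSymmMultilinear K g →
        (∀ v y L, g (op (K := K) b v y :: L) = op (K := K) b (g (v :: L)) y) →
        endAct (op (K := K) a (op (K := K) b v y)) g L =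
          op (K := K) b (endAct (op (K := K) a v) g L) y := by
      induction L with
      | nil => exact fun _ _ => right_comm _ _ _ _ _
      | cons x L ih =>
        intro g Hg hg
        simp only [endAct]
        rw [ih (Hg.tail x) (fun v y L => by
          rw [Hg.perm (.swap _ _ _), hg, Hg.perm (.swap _ _ _)]), right_comm, hg, map_sub,
          LinearMap.sub_apply]
    exact key H.toIsSymmMultilinear (H.op_right b)

theorem isNovikovOp_constOp (y : V) : IsNovikovOp K A (constOp y) where
  perm {L L'} p := by
    cases L with
    | nil => rw [List.nil_perm.1 p]
    | cons v L =>
      cases L' with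
      | nil => simp at p
      | cons v' L' => rfl
  add _ _ _ := by simp [constOp]
  smul _ _ _ := by simp [constOp]
  op_right _ _ _ _ := by simp [constOp]

/-- The operation `(x₁, …, xₖ) ↦ x₁ ⋯ xₖ D_{a₁} ⋯ D_{aₖ} y` for a list `[a₁, …, aₖ]`. -/
def listJet (K : Type*) {A V : Type*} [Field K] [AddCommGroup V] [Module K V]
    [MultiNovikovAlgebra K A V] (y : V) (w : List A) : List V → V :=
  w.foldr (derivOp K) (constOp y)

theorem derivOp_constOp_cons (a : A) (y v : V) (L : List V) :
    derivOp K a (constOp y) (v :: L) = constOp (op (K := K) a v y) L :=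
  endAct_constOp _ _ _

/-- Any `derivOp` vanishes on the empty list, so an iterated one vanishes on lists with fewer than
two entries. -/
theorem derivOp_comm_of (a b : A) (h : List V → V)
    (H : ∀ u v L, derivOp K a (derivOp K b h) (u :: v :: L) =
      derivOp K b (derivOp K a h) (u :: v :: L)) :
    derivOp K a (derivOp K b h) = derivOp K b (derivOp K a h) := by
  funext L
  match L with
  | [] => rfl
  | [u] => simp [derivOp, endAct]
  | u :: v :: L => exact H u v L

/-- The three claims need each other in the induction: symmetry after one more derivative uses
commutation at the previous stage, and commutation at the next stage uses symmetry-type exchanges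
for both derivatives. -/
theorem listJet_isNovikovOp_and_comm (y : V) (w : List A) : IsNovikovOp K A (listJet K y w) ∧
    (∀ a : A, IsNovikovOp K A (derivOp K a (listJet K y w))) ∧
    ∀ a b : A, derivOp K a (derivOp K b (listJet K y w)) =
      derivOp K b (derivOp K a (listJet K y w)) := by
  induction w with
  | nil =>
    refine ⟨isNovikovOp_constOp y, fun a => ?_, fun a b => ?_⟩
    · refine isNovikovOp_derivOp_of_swap a (isNovikovOp_constOp y) fun u v L => ?_
      simp only [listJet, List.foldr_nil, derivOp_constOp_cons, constOp]
    · refine derivOp_comm_of a b _ fun u v L => ?_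
      have h : ∀ a b : A, derivOp K a (derivOp K b (constOp y)) (u :: v :: L) =
          constOp (op (K := K) a u (op (K := K) b v y)) L -
            constOp (op (K := K) b (op (K := K) a u v) y) L := fun a b => by
        have h' : (fun M => derivOp K b (constOp y) (v :: M)) = constOp (op (K := K) b v y) :=
          funext fun M => derivOp_constOp_cons _ _ _ _
        rw [derivOp, endAct, h', endAct_constOp, derivOp_constOp_cons]
      simp only [listJet, List.foldr_nil, h]
      cases L with
      | nil =>
        -- With exactly two arguments, commutation of two derivatives of a constant is the identity
        -- `exchange_ops` itself.
        have := exchange_ops (K := K) a b u v y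
        simp only [constOp]
        rw [← neg_sub, this, neg_sub]
      | cons => simp [constOp]
  | cons c w ih =>
    obtain ⟨ih1, ih2, ih3⟩ := ih
    have hcons : listJet K y (c :: w) = derivOp K c (listJet K y w) := rfl
    rw [hcons]
    refine ⟨ih2 c, fun a => ?_, fun a b => ?_⟩
    · refine isNovikovOp_derivOp_of_swap a (ih2 c) fun u v L => ?_
      -- The joint exchange moves operators and arguments; commuting the operators back leaves only
      -- the arguments exchanged.
      rw [derivOp_derivOp_cons_cons a c ih1.toIsSymmMultilinear, ih3]
    · refine derivOp_comm_of a b _ fun u v L => ?_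
      -- The operators pass through `abc, acb, cab, cba, bca, bac`. Inner pairs commute by
      -- induction; outer pairs commute at the price of exchanging `u` and `v`, which happens twice.
      rw [ih3 b c, derivOp_derivOp_cons_cons a c (ih2 b).toIsSymmMultilinear, ih3 a b,
        derivOp_derivOp_cons_cons c b (ih2 a).toIsSymmMultilinear, ih3 c a]

theorem listJet_perm (y : V) {w w' : List A} (p : w.Perm w') :
    listJet K y w = listJet K y w' := by
  induction p with
  | nil => rfl
  | cons x _ ih => exact congrArg (derivOp K x) ih
  | swap a b l => exact (listJet_isNovikovOp_and_comm y l).2.2 b a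
  | trans _ _ ih ih' => exact ih.trans ih'

/-- The operation `(x₁, …, xₖ) ↦ x₁ ⋯ xₖ D^w y` for a multiset `w` of cardinality `k`. -/
def jetOp (K : Type*) {A V : Type*} [Field K] [AddCommGroup V] [Module K V]
    [MultiNovikovAlgebra K A V] (y : V) (w : Multiset A) : List V → V :=
  Quotient.liftOn w (listJet K y) fun _ _ p => listJet_perm y p

theorem jetOp_zero (y : V) : jetOp K y (0 : Multiset A) = constOp y := rfl

theorem jetOp_cons (y : V) (a : A) (w : Multiset A) :
    jetOp K y (a ::ₘ w) = derivOp K a (jetOp K y w) :=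
  Quotient.inductionOn w fun _ => rfl

theorem isNovikovOp_jetOp (y : V) (w : Multiset A) : IsNovikovOp K A (jetOp K y w) :=
  Quotient.inductionOn w fun l => (listJet_isNovikovOp_and_comm y l).1

/-- Two operations interchange if they commute as operators in their first argument. -/
def Interchange (c h : List V → V) : Prop :=
  ∀ (u : V) (M N : List V), h (c (u :: M) :: N) = c (h (u :: N) :: M)

/-- The first argument `u` enters `derivOp K a c` only through `u ▷ₐ ·`, that is, as the left factor
of a product, and `h` commutes with multiplication on the right. -/
theorem Interchange.derivOp (a : A) {c h : List V → V} (hc : IsSymmMultilinear K c)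
    (hh : IsNovikovOp K A h) (H : Interchange c h) : Interchange (derivOp K a c) h := by
  intro u M N
  simp only [MultiNovikovAlgebra.derivOp]
  induction M generalizing c with
  | nil => exact hh.op_right _ _ _ _
  | cons x M ih =>
    simp only [endAct]
    rw [hh.sub, ih (hc.tail x) fun u M N => by
      rw [hc.perm (.swap _ _ _), H, hc.perm (.swap _ _ _)], H, hh.op_right]

theorem interchange_jetOp (y : V) (w : Multiset A) {h : List V → V} (hh : IsNovikovOp K A h) :
    Interchange (jetOp K y w) h := by
  induction w using Multiset.induction with
  -- A constant has no first argument, so both sides are evaluated off its arity and vanish.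
  | empty => exact fun u M N => by simp [jetOp_zero, constOp, hh.zero]
  | cons a w ih =>
    rw [jetOp_cons]
    exact ih.derivOp a (isNovikovOp_jetOp y w).toIsSymmMultilinear hh

end Operations

end MultiNovikovAlgebra

/-! ### Composition of operations -/

namespace MultiNovikovAlgebra

theorem length_lt_or_exists_append {V : Type*} (k : ℕ) (L : List V) :
    L.length < k ∨ ∃ M N, L = M ++ N ∧ M.length = k := by
  by_cases h : L.length < k
  · exact .inl h
  · exact .inr ⟨L.take k, L.drop k, (List.take_append_drop k L).symm, by simp; omega⟩

section Composition

variable {K A V : Type*} [Field K] [AddCommGroup V] [Module K V]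

/-- Substitution of an operation `c` of arity `k` into the first argument of an operation `h`. -/
def substOp : ℕ → (List V → V) → (List V → V) → List V → V
  | 0, c, h, L => h (c [] :: L)
  | _ + 1, _, _, [] => 0
  | k + 1, c, h, v :: L => substOp k (fun M => c (v :: M)) h L

theorem substOp_append (c h : List V → V) (M N : List V) :
    substOp M.length c h (M ++ N) = h (c M :: N) := by
  induction M generalizing c with
  | nil => rfl
  | cons v M ih => exact ih _

theorem substOp_of_length_lt {k : ℕ} (c h : List V → V) {L : List V} (hL : L.length < k) :
    substOp k c h L = 0 := by
  induction k generalizing c L with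
  | zero => simp at hL
  | succ k ih =>
    cases L with
    | nil => rfl
    | cons v L => exact ih _ (by simpa using hL)

/-- A transposition of neighbours is absorbed by the symmetry of `c` or of `h` unless it straddles
the boundary between their arguments; that case is what `Interchange` is for. -/
theorem substOp_perm (k : ℕ) {c h : List V → V} (hc : IsSymmMultilinear K c)
    (hh : IsSymmMultilinear K h) (H : Interchange c h) {L L' : List V} (p : L.Perm L') :
    substOp k c h L = substOp k c h L' := by
  induction p generalizing k c with
  | nil => rfl
  | @cons x _ _ p ih =>
    cases k with
    | zero => exact hh.perm ((p.cons x).cons _)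
    | succ k =>
      exact ih k (hc.tail x) fun u M N => by
        rw [hc.perm (.swap _ _ _), H, hc.perm (.swap _ _ _)]
  | swap x y l =>
    match k with
    | 0 => exact hh.perm ((List.Perm.swap _ _ _).cons _)
    | 1 =>
      -- The straddling case: after interchanging, both entries are arguments of `h`.
      simp only [substOp]
      rw [H, H, hh.perm (.swap x y l)]
    | k + 2 =>
      simp only [substOp]
      exact congrArg (fun g => substOp k g h l) (funext fun M => hc.perm (.swap _ _ _))
  | trans _ _ ih ih' => exact (ih k hc H).trans (ih' k hc H)

theorem substOp_cons_append {c h : List V → V} (H : Interchange c h) (u : V) (M N : List V) :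
    substOp (M.length + 1) c h (u :: (M ++ N)) = c (h (u :: N) :: M) := by
  rw [← H]
  exact substOp_append _ _ _ _

theorem substOp_sub_left (k : ℕ) (c c' : List V → V) {h : List V → V}
    (hh : IsSymmMultilinear K h) (L : List V) :
    substOp k (fun M => c M - c' M) h L = substOp k c h L - substOp k c' h L := by
  obtain hL | ⟨M, N, rfl, rfl⟩ := length_lt_or_exists_append k L
  · simp [substOp_of_length_lt _ _ hL]
  · simp [substOp_append, hh.sub]

/-- The action is a derivation for composition: the term in which `T` is applied to the intermediate
value of `c` occurs in both summands with opposite signs. -/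
theorem endAct_substOp (T : V →ₗ[K] V) (k : ℕ) (c : List V → V) {h : List V → V}
    (hh : IsSymmMultilinear K h) (L : List V) :
    endAct T (substOp k c h) L =
      substOp k (endAct T c) h L + substOp k c (endAct T h) L := by
  induction k generalizing c L with
  | zero =>
    simp only [substOp, endAct]
    exact (add_sub_cancel _ _).symm
  | succ k ih =>
    cases L with
    | nil => simp [endAct, substOp]
    | cons v L =>
      simp only [endAct, substOp, substOp_sub_left _ _ _ hh]
      exact (congrArg (· - _) (ih _ L)).trans (by abel)

/-- By interchanging, both orders can be rewritten with `h` innermost, sharing one argument `x`;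
there `c` and `d` are successive operators in the first argument and commute by `hcd`. -/
theorem substOp_comm (k l : ℕ) {c d h : List V → V} (hc : IsSymmMultilinear K c)
    (hd : IsSymmMultilinear K d) (hcd : Interchange c d) (hch : Interchange c h)
    (hdh : Interchange d h)
    (hch' : Interchange c (substOp (l + 1) d h)) (hdh' : Interchange d (substOp (k + 1) c h))
    (hs : IsSymmMultilinear K (substOp (l + 1) d (substOp (k + 1) c h))) :
    substOp (k + 1) c (substOp (l + 1) d h) = substOp (l + 1) d (substOp (k + 1) c h) := by
  funext L
  cases L with
  | nil => rfl
  | cons x L =>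
    -- Besides `x`, the two substitutions consume `k + l` entries; shorter lists meet the default
    -- value `0` on both sides.
    have hzero : ∀ {k l : ℕ} {c d : List V → V}, IsSymmMultilinear K c →
        Interchange c (substOp (l + 1) d h) → L.length < k + l →
        substOp (k + 1) c (substOp (l + 1) d h) (x :: L) = 0 := by
      intro k l c d hc H hL
      obtain hL' | ⟨M, N, rfl, rfl⟩ := length_lt_or_exists_append k L
      · exact substOp_of_length_lt _ _ (by simpa using hL')
      · rw [substOp_cons_append H, substOp_of_length_lt, hc.zero]
        simpa using hL
    by_cases hL : L.length < k + l
    · rw [hzero hc hch' hL, hzero hd hdh' (by omega)]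
    · obtain hL' | ⟨M, L', rfl, rfl⟩ := length_lt_or_exists_append k L
      · omega
      obtain hL' | ⟨N, R, rfl, rfl⟩ := length_lt_or_exists_append l L'
      · simp at hL; omega
      have p : (x :: (M ++ (N ++ R))).Perm (x :: (N ++ (M ++ R))) :=
        .cons _ (List.perm_append_comm_assoc _ _ _)
      rw [substOp_cons_append hch', substOp_cons_append hdh, hs.perm p,
        substOp_cons_append hdh', substOp_cons_append hch, hcd]

variable [MultiNovikovAlgebra K A V]

theorem IsNovikovOp.substOp (k : ℕ) {c h : List V → V} (hc : IsNovikovOp K A c)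
    (hh : IsNovikovOp K A h) (H : Interchange c h) : IsNovikovOp K A (substOp (k + 1) c h) where
  perm p := substOp_perm _ hc.toIsSymmMultilinear hh.toIsSymmMultilinear H p
  add u v L := by
    obtain hL | ⟨M, N, rfl, rfl⟩ := length_lt_or_exists_append k L
    · simp only [substOp_of_length_lt (k := k + 1) c h (L := _ :: L) (by simpa using hL),
        add_zero]
    · simp only [substOp_cons_append H, hh.add, hc.add]
  smul r v L := by
    obtain hL | ⟨M, N, rfl, rfl⟩ := length_lt_or_exists_append k L
    · simp only [substOp_of_length_lt (k := k + 1) c h (L := _ :: L) (by simpa using hL),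
        smul_zero]
    · simp only [substOp_cons_append H, hh.smul, hc.smul]
  op_right a v y L := by
    obtain hL | ⟨M, N, rfl, rfl⟩ := length_lt_or_exists_append k L
    · simp only [substOp_of_length_lt (k := k + 1) c h (L := _ :: L) (by simpa using hL),
        map_zero, LinearMap.zero_apply]
    · simp only [substOp_cons_append H, hh.op_right, hc.op_right]

/-- The Leibniz rule for a product of two factors, obtained from the derivation property of
`endAct`. The new argument `v` stands first and must be carried past the arguments of `c`, which is
where the symmetry assumptions enter. -/
theorem derivOp_substOp (a : A) (k : ℕ) {c h : List V → V}
    (hh : IsSymmMultilinear K h) (h0 : h [] = 0)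
    (hd : IsSymmMultilinear K (derivOp K a h))
    (hs : IsSymmMultilinear K (substOp (k + 1) c (derivOp K a h))) (L : List V) :
    derivOp K a (substOp (k + 1) c h) L =
      substOp (k + 2) (derivOp K a c) h L + substOp (k + 1) c (derivOp K a h) L := by
  cases L with
  | nil => simp [derivOp, substOp]
  | cons v L =>
    have h1 : derivOp K a (substOp (k + 1) c h) (v :: L) =
      endAct (op (K := K) a v) (substOp (k + 1) c h) L := rfl
    rw [h1, endAct_substOp _ _ _ hh]
    refine congrArg₂ (· + ·) rfl ?_
    obtain hL | ⟨M, N, rfl, hM⟩ := length_lt_or_exists_append (k + 1) L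
    · rw [substOp_of_length_lt _ _ hL]
      obtain hL' | hL' := Nat.lt_or_ge L.length k
      · rw [substOp_of_length_lt _ _ (by simpa using hL')]
      -- Here `v :: L` just fills `c`, and `derivOp K a h` on a single entry is a product with `h []
      -- = 0`.
      · have : k + 1 = (v :: L).length := by simp; omega
        have h2 := substOp_append c (derivOp K a h) (v :: L) []
        rw [← this, List.append_nil] at h2
        rw [h2]
        simp [derivOp, endAct, h0]
    · have p : (v :: (M ++ N)).Perm (M ++ v :: N) := List.perm_middle.symm
      rw [hs.perm p, ← hM, substOp_append, substOp_append,
        hd.perm (.swap v (c M) N)]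
      rfl

/-- The operation of arity one given by the identity. -/
def idOp : List V → V
  | [x] => x
  | _ => 0

theorem isNovikovOp_idOp : IsNovikovOp K A (idOp : List V → V) where
  perm {L L'} p := by
    match L with
    | [] => rw [List.nil_perm.1 p]
    | [x] => rw [List.singleton_perm.1 p]
    | x :: y :: L =>
      have := p.length_eq
      match L' with
      | [] => simp at this
      | [x] => simp at this
      | x' :: y' :: L' => rfl
  add u v L := by cases L <;> simp [idOp]
  smul u v L := by cases L <;> simp [idOp]
  op_right a v y L := by cases L <;> simp [idOp]

/-- The identity is multiplication by `1`, which derivations kill; on two entries the terms `v ▷ₐ w`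
cancel. -/
theorem derivOp_idOp (a : A) (L : List V) : derivOp K a idOp L = 0 := by
  match L with
  | [] => rfl
  | [v] => simp [derivOp, endAct, idOp]
  | [v, w] => simp [derivOp, endAct, idOp]
  | v :: w :: x :: L =>
    simp [derivOp, endAct, idOp, endAct_zero]

end Composition

end MultiNovikovAlgebra

/-! ### Values of weight-one monomials and the product rule -/

namespace MultiNovikovAlgebra

section Contraction

/-- The terms of the Leibniz rule for a derivation applied to a product of variables indexed by a
list of pairs `(x, w)`, where the derivation maps the variable `(x, w)` to `(x, a ::ₘ w)`. -/
def leibnizList {A X : Type*} (a : A) : List (X × Multiset A) → List (List (X × Multiset A))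
  | [] => []
  | i :: μ => ((i.1, a ::ₘ i.2) :: μ) :: (leibnizList a μ).map (i :: ·)

theorem leibnizList_append {A X : Type*} (a : A) (μ ν : List (X × Multiset A)) :
    leibnizList a (μ ++ ν) =
      (leibnizList a μ).map (· ++ ν) ++ (leibnizList a ν).map (μ ++ ·) := by
  induction μ with
  | nil => simp [leibnizList]
  | cons i μ ih => simp [leibnizList, ih, Function.comp_def]

theorem leibnizList_ne_zero {A X : Type*} (a : A) {μ : List (X × Multiset A)} (hμ : ∀ i ∈ μ, i.2 ≠ 0) :
    ∀ ν ∈ leibnizList a μ, ∀ i ∈ ν, i.2 ≠ 0 := by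
  induction μ with
  | nil => simp [leibnizList]
  | cons i μ ih =>
    intro ν hν
    simp only [leibnizList, List.mem_cons, List.mem_map] at hν
    obtain rfl | ⟨ν, hν, rfl⟩ := hν
    · intro j hj
      obtain rfl | hj := List.mem_cons.1 hj
      · simp
      · exact hμ j (by simp [hj])
    · intro j hj
      obtain rfl | hj := List.mem_cons.1 hj
      · exact hμ j (by simp)
      · exact ih (fun j hj => hμ j (by simp [hj])) ν hν j hj

/-- The values of the generators corresponding to the factors `(x, 0)` of a monomial. -/
def leafValues {A X V : Type*} (f : X → V) (μ : List (X × Multiset A)) : List V :=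
  (μ.filter fun i => i.2.card = 0).map fun i => f i.1

theorem leafValues_append {A X V : Type*} (f : X → V) (μ ν : List (X × Multiset A)) :
    leafValues f (μ ++ ν) = leafValues f μ ++ leafValues f ν := by
  simp [leafValues]

theorem leafValues_leaves {A X V : Type*} (f : X → V) (Λ : List X) :
    leafValues f (Λ.map fun x => (x, (0 : Multiset A))) = Λ.map f := by
  simp [leafValues, List.filter_map, Function.comp_def]

theorem leafValues_eq_nil {A X V : Type*} (f : X → V) {μ : List (X × Multiset A)} (hμ : ∀ i ∈ μ, i.2 ≠ 0) :
    leafValues f μ = [] := by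
  simpa [leafValues] using fun x w h => hμ (x, w) h

variable {K A V X : Type*} [Field K] [AddCommGroup V] [Module K V] [MultiNovikovAlgebra K A V]

/-- The operator on operations given by a factor `(x, w)` of a monomial; factors with `w = 0` are
disregarded. -/
def factorOp (K : Type*) {A V X : Type*} [Field K] [AddCommGroup V] [Module K V]
    [MultiNovikovAlgebra K A V] (f : X → V) (i : X × Multiset A) (h : List V → V) : List V → V :=
  if i.2.card = 0 then h else substOp i.2.card (jetOp K (f i.1) i.2) h

theorem factorOp_of_ne (f : X → V) {i : X × Multiset A} (hi : i.2 ≠ 0) (h : List V → V) :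
    factorOp K f i h = substOp (i.2.card - 1 + 1) (jetOp K (f i.1) i.2) h := by
  have h' : i.2.card ≠ 0 := by simpa using hi
  rw [factorOp, if_neg h', Nat.sub_add_cancel (Nat.pos_of_ne_zero h')]

theorem isNovikovOp_factorOp (f : X → V) (i : X × Multiset A) {h : List V → V}
    (hh : IsNovikovOp K A h) : IsNovikovOp K A (factorOp K f i h) := by
  by_cases hi : i.2 = 0
  · simpa [factorOp, hi] using hh
  · rw [factorOp_of_ne f hi]
    exact (isNovikovOp_jetOp _ _).substOp _ hh (interchange_jetOp _ _ hh)

theorem factorOp_comm (f : X → V) (i j : X × Multiset A) {h : List V → V}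
    (hh : IsNovikovOp K A h) :
    factorOp K f i (factorOp K f j h) = factorOp K f j (factorOp K f i h) := by
  by_cases hi : i.2 = 0
  · simp [factorOp, hi]
  by_cases hj : j.2 = 0
  · simp [factorOp, hj]
  have H := isNovikovOp_factorOp f i hh
  have H' := isNovikovOp_factorOp f j hh
  have H'' := isNovikovOp_factorOp f j H
  simp only [factorOp_of_ne f hi, factorOp_of_ne f hj] at H H' H'' ⊢
  exact substOp_comm _ _ (isNovikovOp_jetOp _ _).toIsSymmMultilinear
    (isNovikovOp_jetOp _ _).toIsSymmMultilinear (interchange_jetOp _ _ (isNovikovOp_jetOp _ _))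
    (interchange_jetOp _ _ hh) (interchange_jetOp _ _ hh) (interchange_jetOp _ _ H')
    (interchange_jetOp _ _ H) H''.toIsSymmMultilinear

/-- The operation defined by the factors `(x, w)`, `w ≠ 0`, of a monomial. -/
def contraction (K : Type*) {A V X : Type*} [Field K] [AddCommGroup V] [Module K V]
    [MultiNovikovAlgebra K A V] (f : X → V) (μ : List (X × Multiset A)) : List V → V :=
  μ.foldr (factorOp K f) idOp

theorem contraction_cons (f : X → V) (i : X × Multiset A) (μ : List (X × Multiset A)) :
    contraction K f (i :: μ) = factorOp K f i (contraction K f μ) := rfl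

theorem isNovikovOp_contraction (f : X → V) (μ : List (X × Multiset A)) :
    IsNovikovOp K A (contraction K f μ) := by
  induction μ with
  | nil => exact isNovikovOp_idOp
  | cons i μ ih => exact isNovikovOp_factorOp f i ih

theorem contraction_perm (f : X → V) {μ ν : List (X × Multiset A)} (p : μ.Perm ν) :
    contraction K f μ = contraction K f ν := by
  induction p with
  | nil => rfl
  | cons x _ ih => exact congrArg (factorOp K f x) ih
  | swap i j μ => exact factorOp_comm f j i (isNovikovOp_contraction f μ)
  | trans _ _ ih ih' => exact ih.trans ih'

theorem contraction_nil_right (f : X → V) (μ : List (X × Multiset A)) :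
    contraction K f μ [] = 0 := by
  induction μ with
  | nil => rfl
  | cons i μ ih =>
    rw [contraction_cons]
    by_cases hi : i.2 = 0
    · simpa [factorOp, hi] using ih
    · rw [factorOp_of_ne f hi]
      rfl

theorem contraction_append_leaves (f : X → V) (μ : List (X × Multiset A)) (Λ : List X) :
    contraction K f (μ ++ Λ.map fun x => (x, (0 : Multiset A))) = contraction K f μ := by
  induction μ with
  | nil =>
    induction Λ with
    | nil => rfl
    | cons x Λ ih =>
      simp only [List.nil_append, List.map_cons, contraction_cons] at ih ⊢
      rw [ih]
      simp [factorOp]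
  | cons i μ ih => rw [List.cons_append, contraction_cons, ih, ← contraction_cons]

theorem factorOp_add (f : X → V) (i : X × Multiset A) (h h' : List V → V) :
    factorOp K f i (h + h') = factorOp K f i h + factorOp K f i h' := by
  by_cases hi : i.2 = 0
  · simp [factorOp, hi]
  · simp only [factorOp_of_ne f hi]
    funext L
    obtain hL | ⟨M, N, rfl, hM⟩ := length_lt_or_exists_append (i.2.card - 1 + 1) L
    · simp [substOp_of_length_lt _ _ hL]
    · simp [← hM, substOp_append]

theorem factorOp_list_sum (f : X → V) (i : X × Multiset A) (l : List (List V → V)) :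
    factorOp K f i l.sum = (l.map (factorOp K f i)).sum := by
  induction l with
  | nil =>
    have := factorOp_add (K := K) f i 0 0
    rw [add_zero, left_eq_add] at this
    simpa using this
  | cons h l ih => rw [List.sum_cons, factorOp_add, ih, List.map_cons, List.sum_cons]

theorem isNovikovOp_list_sum {l : List (List V → V)} (hl : ∀ h ∈ l, IsNovikovOp K A h) :
    IsNovikovOp K A l.sum := by
  induction l with
  | nil => constructor <;> [constructor; skip] <;> simp
  | cons h l ih =>
    have h1 := hl h (by simp)
    have h2 := ih fun h' hh => hl h' (by simp [hh])
    rw [List.sum_cons]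
    refine { perm := fun p => ?_, add := fun u v L => ?_, smul := fun r v L => ?_,
             op_right := fun a v y L => ?_ }
    · simp only [Pi.add_apply, h1.perm p, h2.perm p]
    · simp only [Pi.add_apply, h1.add, h2.add]; abel
    · simp only [Pi.add_apply, h1.smul, h2.smul, smul_add]
    · simp only [Pi.add_apply, h1.op_right, h2.op_right, map_add, LinearMap.add_apply]

/-- Iterated Leibniz rule. Leaves are excluded because `factorOp` ignores them; differentiating a
leaf is handled by `op_contraction_leaves`. -/
theorem derivOp_contraction (f : X → V) (a : A) {μ : List (X × Multiset A)}
    (hμ : ∀ i ∈ μ, i.2 ≠ 0) :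
    derivOp K a (contraction K f μ) = ((leibnizList a μ).map (contraction K f)).sum := by
  induction μ with
  | nil => exact funext fun L => derivOp_idOp a L
  | cons i μ ih =>
    have hi : i.2 ≠ 0 := hμ i (by simp)
    have ih := ih fun j hj => hμ j (by simp [hj])
    -- Symmetry of the derivative is read off the inductive formula, a sum of contractions.
    have H : IsNovikovOp K A (derivOp K a (contraction K f μ)) := by
      rw [ih]
      refine isNovikovOp_list_sum fun h hh => ?_
      obtain ⟨ν, -, rfl⟩ := List.mem_map.1 hh
      exact isNovikovOp_contraction f ν
    have H' := isNovikovOp_factorOp f i H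
    have e : (leibnizList a μ).map (contraction K f ∘ (i :: ·)) =
        ((leibnizList a μ).map (contraction K f)).map (factorOp K f i) := by
      rw [List.map_map]; rfl
    rw [leibnizList, List.map_cons, List.sum_cons, List.map_map, e, ← factorOp_list_sum, ← ih]
    rw [contraction_cons, contraction_cons, factorOp_of_ne f hi,
      factorOp_of_ne f (i := (i.1, a ::ₘ i.2)) (by simp)]
    rw [factorOp_of_ne f hi] at H' ⊢
    funext L
    rw [derivOp_substOp a _ (isNovikovOp_contraction f μ).toIsSymmMultilinear
      (contraction_nil_right f μ) H.toIsSymmMultilinear H'.toIsSymmMultilinear]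
    have hc : (a ::ₘ i.2).card - 1 + 1 = i.2.card - 1 + 2 := by
      have : i.2.card ≠ 0 := by simpa using hi
      simp; omega
    simp only [Pi.add_apply, hc, jetOp_cons]

/-- The value of a monomial `∏ D^w z_x` of weight one in a multi-Novikov algebra. -/
def monomialValue (K : Type*) {A V X : Type*} [Field K] [AddCommGroup V] [Module K V]
    [MultiNovikovAlgebra K A V] (f : X → V) (μ : List (X × Multiset A)) : V :=
  contraction K f μ (leafValues f μ)

theorem monomialValue_perm (f : X → V) {μ ν : List (X × Multiset A)} (p : μ.Perm ν) :
    monomialValue K f μ = monomialValue K f ν := by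
  rw [monomialValue, contraction_perm f p]
  exact (isNovikovOp_contraction f ν).perm ((p.filter _).map _)

theorem exists_perm_append_leaves {A X : Type*} (μ : List (X × Multiset A)) :
    ∃ (Φ : List (X × Multiset A)) (Λ : List X), (∀ i ∈ Φ, i.2 ≠ 0) ∧
      μ.Perm (Φ ++ Λ.map fun x => (x, (0 : Multiset A))) := by
  induction μ with
  | nil => exact ⟨[], [], by simp, by simp⟩
  | cons i μ ih =>
    obtain ⟨Φ, Λ, hΦ, p⟩ := ih
    by_cases hi : i.2 = 0
    · refine ⟨Φ, i.1 :: Λ, hΦ, ?_⟩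
      have : i = (i.1, 0) := Prod.ext rfl hi
      rw [List.map_cons, ← this]
      exact (p.cons i).trans List.perm_middle.symm
    · exact ⟨i :: Φ, Λ, by simpa [hi] using hΦ, p.cons i⟩

theorem contraction_append_cons_leaf (f : X → V) (μ ν : List (X × Multiset A)) (x : X) :
    contraction K f (μ ++ (x, 0) :: ν) = contraction K f (μ ++ ν) := by
  rw [contraction_perm f List.perm_middle, contraction_cons]
  simp [factorOp]

/-- By definition of `endAct`, the product is the action plus the terms with one leaf value `f x`
replaced by `v ▷ₐ f x`. Such a term is the contraction with the leaf `(x, 0)` turned into the unary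
factor `(x, {a})` and fed with `v`. The list `Λ₀` holds the leaf values already passed in the
induction. -/
theorem op_contraction_leaves (f : X → V) (a : A) (v : V) (μ : List (X × Multiset A))
    (Λ₀ : List V) (Λ : List X) :
    op (K := K) a v (contraction K f μ (Λ₀ ++ Λ.map f)) =
      endAct (op (K := K) a v) (fun M => contraction K f μ (Λ₀ ++ M)) (Λ.map f) +
      ((leibnizList a (Λ.map fun x => (x, (0 : Multiset A)))).map fun ν =>
        contraction K f (μ ++ ν) (v :: (Λ₀ ++ leafValues f ν))).sum := by
  induction Λ generalizing Λ₀ with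
  | nil => simp [endAct, leibnizList]
  | cons x Λ ih =>
    have h := ih (Λ₀ ++ [f x])
    simp only [List.append_assoc, List.cons_append, List.nil_append] at h
    have hx : contraction K f
        (μ ++ (x, a ::ₘ 0) :: Λ.map fun x => (x, (0 : Multiset A)))
        (v :: (Λ₀ ++ Λ.map f)) =
        contraction K f μ (Λ₀ ++ op (K := K) a v (f x) :: Λ.map f) := by
      rw [contraction_perm f List.perm_middle, contraction_cons, contraction_append_leaves,
        (isNovikovOp_contraction f μ).perm List.perm_middle]
      rfl
    have hl : leafValues f ((x, a ::ₘ (0 : Multiset A)) :: Λ.map fun x => (x, (0 : Multiset A))) = Λ.map f := by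
      refine Eq.trans ?_ (leafValues_leaves (A := A) f Λ)
      simp [leafValues]
    have hl' : ∀ ν : List (X × Multiset A),
        leafValues f ((x, 0) :: ν) = f x :: leafValues f ν := fun ν => by simp [leafValues]
    simp only [List.map_cons, leibnizList, endAct, List.sum_cons, List.map_map,
      Function.comp_def, hl, hx, h, hl', contraction_append_cons_leaf]
    abel

/-- The two summands of `op_contraction_leaves` match the two halves of the Leibniz rule, with the
derivative hitting `Φ` or a leaf. -/
theorem op_monomialValue (f : X → V) (a : A) (v : V) {Φ : List (X × Multiset A)}
    (hΦ : ∀ i ∈ Φ, i.2 ≠ 0) (Λ : List X) :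
    op (K := K) a v
        (monomialValue K f (Φ ++ Λ.map fun x => (x, (0 : Multiset A)))) =
      ((leibnizList a (Φ ++ Λ.map fun x => (x, (0 : Multiset A)))).map fun ν =>
        contraction K f ν (v :: leafValues f ν)).sum := by
  have h := op_contraction_leaves (K := K) f a v Φ [] Λ
  have h' : endAct (op (K := K) a v) (contraction K f Φ) (Λ.map f) =
    derivOp K a (contraction K f Φ) (v :: Λ.map f) := rfl
  have hsum : ∀ (l : List (List V → V)) (L : List V), l.sum L = (l.map fun h => h L).sum :=
    fun l L => by induction l <;> simp [*]
  simp only [List.nil_append] at h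
  rw [monomialValue, contraction_append_leaves, leafValues_append, leafValues_eq_nil f hΦ,
    leafValues_leaves, List.nil_append, h, h', derivOp_contraction f a hΦ, hsum,
    leibnizList_append, List.map_append, List.sum_append, List.map_map, List.map_map,
    List.map_map]
  refine congrArg₂ (· + ·) (congrArg _ (List.map_congr_left fun ν hν => ?_))
    (congrArg _ (List.map_congr_left fun ν hν => ?_))
  · simp only [Function.comp_apply, contraction_append_leaves, leafValues_append,
      leafValues_leaves, leafValues_eq_nil f (leibnizList_ne_zero a hΦ ν hν), List.nil_append]
  · simp only [Function.comp_apply, leafValues_append, leafValues_eq_nil f hΦ, List.nil_append]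

/-- The weight `∑ (1 - |w|)` of a list of pairs `(x, w)`. -/
def listWeight {A X : Type*} (μ : List (X × Multiset A)) : ℤ :=
  (μ.map fun i => 1 - (i.2.card : ℤ)).sum

theorem listWeight_nonpos {A X : Type*} {Φ : List (X × Multiset A)} (hΦ : ∀ i ∈ Φ, i.2 ≠ 0) :
    listWeight Φ ≤ 0 := by
  induction Φ with
  | nil => simp [listWeight]
  | cons i Φ ih =>
    have hi : i.2.card ≠ 0 := by simpa using hΦ i (by simp)
    have := ih fun j hj => hΦ j (by simp [hj])
    simp only [listWeight, List.map_cons, List.sum_cons] at this ⊢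
    omega

/-- The condition on `M` says that its length is the arity of the composite of `Φ`, so all of `M` is
absorbed before `ν` acts and plugging in a value amounts to concatenating factors. -/
theorem contraction_contraction (f : X → V) {Φ : List (X × Multiset A)}
    (hΦ : ∀ i ∈ Φ, i.2 ≠ 0) (ν : List (X × Multiset A)) (M N : List V)
    (hM : M.length + listWeight Φ = 1) :
    contraction K f ν (contraction K f Φ M :: N) = contraction K f (Φ ++ ν) (M ++ N) := by
  induction Φ generalizing M with
  | nil =>
    obtain ⟨x, rfl⟩ := List.length_eq_one_iff.1 (by simpa [listWeight] using hM)
    rfl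
  | cons i Φ ih =>
    have hi : i.2 ≠ 0 := hΦ i (by simp)
    have hi' : i.2.card ≠ 0 := by simpa using hi
    have hΦ' : ∀ j ∈ Φ, j.2 ≠ 0 := fun j hj => hΦ j (by simp [hj])
    have hw := listWeight_nonpos hΦ'
    have hM' : M.length + (1 - (i.2.card : ℤ) + listWeight Φ) = 1 := by
      simpa [listWeight] using hM
    rw [List.cons_append, contraction_cons, contraction_cons, factorOp, factorOp,
      if_neg hi', if_neg hi']
    obtain hL | ⟨M₁, M₂, rfl, hM₁⟩ := length_lt_or_exists_append i.2.card M
    -- As `Φ` has nonpositive weight, `M` has at least `|w|` entries for the first factor `(x, w)`.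
    · omega
    · rw [List.append_assoc, ← hM₁, substOp_append, substOp_append, ih hΦ', List.cons_append]
      rw [List.length_append] at hM'
      rw [List.length_cons]
      push_cast at hM' ⊢
      omega

theorem op_monomialValue_monomialValue (f : X → V) (a : A) {Φ Φ' : List (X × Multiset A)}
    (hΦ : ∀ i ∈ Φ, i.2 ≠ 0) (hΦ' : ∀ i ∈ Φ', i.2 ≠ 0) (Λ Λ' : List X)
    (hw : listWeight (Φ ++ Λ.map fun x => (x, (0 : Multiset A))) = 1) :
    op (K := K) a (monomialValue K f (Φ ++ Λ.map fun x => (x, (0 : Multiset A))))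
        (monomialValue K f (Φ' ++ Λ'.map fun x => (x, (0 : Multiset A)))) =
      ((leibnizList a (Φ' ++ Λ'.map fun x => (x, (0 : Multiset A)))).map fun ν =>
        monomialValue K f ((Φ ++ Λ.map fun x => (x, (0 : Multiset A))) ++ ν)).sum := by
  rw [op_monomialValue f a _ hΦ']
  refine congrArg _ (List.map_congr_left fun ν _ => ?_)
  have hl : ((Λ.map f).length : ℤ) + listWeight Φ = 1 := by
    rw [← hw]
    simp [listWeight, Function.comp_def, add_comm]
  rw [monomialValue, contraction_append_leaves, leafValues_append, leafValues_eq_nil f hΦ,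
    leafValues_leaves, List.nil_append, contraction_contraction f hΦ _ _ _ hl, monomialValue,
    leafValues_append, leafValues_append, leafValues_eq_nil f hΦ, leafValues_leaves,
    List.nil_append]
  have p : (Φ ++ (Λ.map fun x => (x, (0 : Multiset A))) ++ ν).Perm
      (Φ ++ ν ++ Λ.map fun x => (x, (0 : Multiset A))) := by
    rw [List.append_assoc, List.append_assoc]
    exact List.perm_append_comm.append_left _
  rw [contraction_perm f p, contraction_append_leaves]

end Contraction

end MultiNovikovAlgebra

/-! ### Comparison with multiplication in a commutative differential algebra -/

namespace MultiNovikovAlgebra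

section Representation

variable {K A V X C : Type*} [Field K] [AddCommGroup V] [Module K V] [MultiNovikovAlgebra K A V]
  [CommRing C] [Algebra K C] (Θ : V →ₗ[K] C)

/-- The operation `h` of arity `k` is multiplication by `q` under a linear map to a commutative
algebra. -/
def Represents (k : ℕ) (h : List V → V) (q : C) : Prop :=
  ∀ L : List V, L.length = k → Θ (h L) = q * (L.map Θ).prod

variable {Θ}

/-- Under `Θ` the correction terms cancel every Leibniz term in which `D a` hits an argument; only
`D a q` survives. -/
theorem Represents.derivOp {D : A → Derivation K C C}
    (hΘ : ∀ a x y, Θ (op (K := K) a x y) = Θ x * D a (Θ y)) (a : A) {k : ℕ} {h : List V → V}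
    {q : C} (H : Represents Θ k h q) : Represents Θ (k + 1) (derivOp K a h) (D a q) := by
  have key : ∀ (L : List V) (h : List V → V) (q : C) (v : V), Represents Θ L.length h q →
      Θ (endAct (op (K := K) a v) h L) = Θ v * D a q * (L.map Θ).prod := by
    intro L
    induction L with
    | nil =>
      intro h q v H
      have := H [] rfl
      simp [endAct, hΘ, this]
    | cons x L ih =>
      intro h q v H
      have h1 : Represents Θ L.length (fun M => h (x :: M)) (q * Θ x) := fun M hM => by
        rw [H (x :: M) (by simp [hM]), List.map_cons, List.prod_cons, mul_assoc]
      rw [endAct, map_sub, ih _ _ v h1, H (op (K := K) a v x :: L) (by simp), List.map_cons,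
        List.map_cons, List.prod_cons, List.prod_cons, hΘ, Derivation.leibniz, smul_eq_mul,
        smul_eq_mul]
      ring
  intro L hL
  cases L with
  | nil => simp at hL
  | cons v L =>
    obtain rfl : L.length = k := by simpa using hL
    rw [MultiNovikovAlgebra.derivOp, key L h q v H, List.map_cons, List.prod_cons]
    ring

theorem represents_jetOp {D : A → Derivation K C C}
    (hΘ : ∀ a x y, Θ (op (K := K) a x y) = Θ x * D a (Θ y)) {f : X → V}
    {Z : X × Multiset A → C} (hZ : ∀ x, Θ (f x) = Z (x, 0))
    (hD : ∀ a x w, D a (Z (x, w)) = Z (x, a ::ₘ w)) (x : X) (w : Multiset A) :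
    Represents Θ w.card (jetOp K (f x) w) (Z (x, w)) := by
  induction w using Multiset.induction with
  | empty =>
    intro L hL
    obtain rfl : L = [] := by simpa using hL
    simp [jetOp_zero, constOp, hZ]
  | cons a w ih =>
    rw [jetOp_cons, Multiset.card_cons, ← hD]
    exact ih.derivOp hΘ a

theorem represents_contraction {D : A → Derivation K C C}
    (hΘ : ∀ a x y, Θ (op (K := K) a x y) = Θ x * D a (Θ y)) {f : X → V}
    {Z : X × Multiset A → C} (hZ : ∀ x, Θ (f x) = Z (x, 0))
    (hD : ∀ a x w, D a (Z (x, w)) = Z (x, a ::ₘ w)) {Φ : List (X × Multiset A)}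
    (hΦ : ∀ i ∈ Φ, i.2 ≠ 0) (L : List V) (hL : L.length + listWeight Φ = 1) :
    Θ (contraction K f Φ L) = (Φ.map Z).prod * (L.map Θ).prod := by
  induction Φ generalizing L with
  | nil =>
    obtain ⟨x, rfl⟩ := List.length_eq_one_iff.1 (by simpa [listWeight] using hL)
    simp [contraction, idOp]
  | cons i Φ ih =>
    have hi' : i.2.card ≠ 0 := by simpa using hΦ i (by simp)
    have hΦ' : ∀ j ∈ Φ, j.2 ≠ 0 := fun j hj => hΦ j (by simp [hj])
    have hw := listWeight_nonpos hΦ'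
    have hM' : L.length + (1 - (i.2.card : ℤ) + listWeight Φ) = 1 := by
      simpa [listWeight] using hL
    rw [contraction_cons, factorOp, if_neg hi']
    obtain hL | ⟨M, N, rfl, hM⟩ := length_lt_or_exists_append i.2.card L
    · omega
    · rw [List.length_append] at hM'
      rw [← hM, substOp_append, ih hΦ', List.map_cons, List.map_cons, List.map_append,
        List.prod_cons, List.prod_cons, List.prod_append,
        represents_jetOp hΘ hZ hD i.1 i.2 M hM]
      · ring
      · rw [List.length_cons]
        push_cast at hM' ⊢
        omega

theorem map_monomialValue {D : A → Derivation K C C}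
    (hΘ : ∀ a x y, Θ (op (K := K) a x y) = Θ x * D a (Θ y)) {f : X → V}
    {Z : X × Multiset A → C} (hZ : ∀ x, Θ (f x) = Z (x, 0))
    (hD : ∀ a x w, D a (Z (x, w)) = Z (x, a ::ₘ w)) {Φ : List (X × Multiset A)}
    (hΦ : ∀ i ∈ Φ, i.2 ≠ 0) (Λ : List X)
    (hw : listWeight (Φ ++ Λ.map fun x => (x, (0 : Multiset A))) = 1) :
    Θ (monomialValue K f (Φ ++ Λ.map fun x => (x, (0 : Multiset A)))) =
      ((Φ ++ Λ.map fun x => (x, (0 : Multiset A))).map Z).prod := by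
  have hl : ((Λ.map f).length : ℤ) + listWeight Φ = 1 := by
    rw [← hw]
    simp [listWeight, Function.comp_def, add_comm]
  rw [monomialValue, contraction_append_leaves, leafValues_append, leafValues_eq_nil f hΦ,
    leafValues_leaves, List.nil_append, represents_contraction hΘ hZ hD hΦ _ hl]
  simp [Function.comp_def, hZ]

end Representation

/-! ### Monomial values as a linear map on differential polynomials -/

section Polynomials

open MvPolynomial

variable {K A V X : Type*} [Field K] [AddCommGroup V] [Module K V] [MultiNovikovAlgebra K A V]

/-- The derivation of the polynomial algebra in the variables `D^w z_x` mapping `D^w z_x` to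
`D_a D^w z_x`. -/
noncomputable def polyDeriv (K : Type*) {A X : Type*} [Field K] (a : A) :
    Derivation K (MvPolynomial (X × Multiset A) K) (MvPolynomial (X × Multiset A) K) :=
  mkDerivation K fun i => MvPolynomial.X (i.1, a ::ₘ i.2)

theorem polyDeriv_X (a : A) (i : X × Multiset A) :
    polyDeriv K a (MvPolynomial.X i) = MvPolynomial.X (i.1, a ::ₘ i.2) :=
  mkDerivation_X _ _ _

theorem polyDeriv_list_prod (a : A) (μ : List (X × Multiset A)) :
    polyDeriv K a (μ.map MvPolynomial.X).prod =
      ((leibnizList a μ).map fun ν => (ν.map (MvPolynomial.X (R := K))).prod).sum := by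
  induction μ with
  | nil => simp [leibnizList]
  | cons i μ ih =>
    rw [List.map_cons, List.prod_cons, Derivation.leibniz, ih, polyDeriv_X, leibnizList,
      List.map_cons, List.sum_cons, List.map_map, smul_eq_mul, smul_eq_mul, add_comm,
      ← List.sum_map_mul_left]
    simp [Function.comp_def, mul_comm]

/-- The linear map from polynomials in the variables `D^w z_x` to a multi-Novikov algebra given by
the values of monomials. -/
noncomputable def polyValue (K : Type*) {A V X : Type*} [Field K] [AddCommGroup V] [Module K V]
    [MultiNovikovAlgebra K A V] (f : X → V) : MvPolynomial (X × Multiset A) K →ₗ[K] V :=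
  (basisMonomials (X × Multiset A) K).constr K fun s =>
    monomialValue K f (Finsupp.toMultiset s).toList

theorem toMultiset_map_prod {ι M : Type*} [CommMonoid M] (s : ι →₀ ℕ) (g : ι → M) :
    ((Finsupp.toMultiset s).map g).prod = s.prod fun i c => g i ^ c := by
  classical
  induction s using Finsupp.induction_linear with
  | zero => simp
  | add s t hs ht =>
    rw [map_add, Multiset.map_add, Multiset.prod_add, hs, ht,
      Finsupp.prod_add_index' (by simp) (by simp [pow_add])]
  | single i c => rw [Finsupp.toMultiset_single, Multiset.map_nsmul, Multiset.prod_nsmul]; simp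

theorem toMultiset_map_sum {ι M : Type*} [AddCommMonoid M] (s : ι →₀ ℕ) (g : ι → M) :
    ((Finsupp.toMultiset s).map g).sum = s.sum fun i c => c • g i :=
  toMultiset_map_prod (M := Multiplicative M) s g

theorem list_prod_X {σ : Type*} {s : σ →₀ ℕ} {μ : List σ}
    (h : Finsupp.toMultiset s = (μ : Multiset σ)) :
    (μ.map (MvPolynomial.X (R := K))).prod = MvPolynomial.monomial s 1 := by
  rw [← Multiset.prod_coe, ← Multiset.map_coe, ← h, toMultiset_map_prod, monomial_eq, C_1, one_mul]

theorem polyValue_list_prod (f : X → V) (μ : List (X × Multiset A)) :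
    polyValue K f (μ.map MvPolynomial.X).prod = monomialValue K f μ := by
  classical
  have h := Multiset.toFinsupp_toMultiset (μ : Multiset (X × Multiset A))
  have h' := (basisMonomials (X × Multiset A) K).constr_basis K
    (fun s => monomialValue K f (Finsupp.toMultiset s).toList)
    (Multiset.toFinsupp (μ : Multiset (X × Multiset A)))
  rw [coe_basisMonomials] at h'
  rw [list_prod_X h, polyValue]
  refine h'.trans ?_
  rw [h]
  refine monomialValue_perm f ?_
  rw [← Multiset.coe_eq_coe, Multiset.coe_toList]

theorem polyValue_X (f : X → V) (x : X) :
    polyValue K f (MvPolynomial.X (x, (0 : Multiset A))) = f x := by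
  have := polyValue_list_prod (K := K) f [(x, (0 : Multiset A))]
  simpa [monomialValue, contraction, leafValues, factorOp, idOp] using this

/-- The span of the monomials of weight one. -/
def populatedPoly (K A X : Type*) [Field K] : Submodule K (MvPolynomial (X × Multiset A) K) :=
  weightedHomogeneousSubmodule K (fun i => 1 - (i.2.card : ℤ)) 1

theorem populatedPoly_induction {p : MvPolynomial (X × Multiset A) K → Prop} (h0 : p 0)
    (hadd : ∀ x y, p x → p y → p (x + y)) (hsmul : ∀ (r : K) x, p x → p (r • x))
    (hmon : ∀ (Φ : List (X × Multiset A)) (Λ : List X), (∀ i ∈ Φ, i.2 ≠ 0) →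
      listWeight (Φ ++ Λ.map fun x => (x, (0 : Multiset A))) = 1 →
      p ((Φ ++ Λ.map fun x => (x, (0 : Multiset A))).map MvPolynomial.X).prod)
    {x : MvPolynomial (X × Multiset A) K} (hx : x ∈ populatedPoly K A X) : p x := by
  rw [x.as_sum]
  refine Finset.sum_induction _ p (fun x y => hadd x y) h0 fun s hs => ?_
  have hs' := hx (mem_support_iff.1 hs)
  obtain ⟨Φ, Λ, hΦ, hp⟩ := exists_perm_append_leaves (Finsupp.toMultiset s).toList
  have e : (Finsupp.toMultiset s) =
      ((Φ ++ Λ.map fun x => (x, (0 : Multiset A)) : List _) : Multiset (X × Multiset A)) := by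
    rw [← Multiset.coe_eq_coe.2 hp, Multiset.coe_toList]
  have h1 := hmon Φ Λ hΦ (by
    rw [← hs', listWeight, ← Multiset.sum_coe, ← Multiset.map_coe, ← e, Finsupp.weight_apply,
      toMultiset_map_sum])
  rw [list_prod_X e] at h1
  simpa [smul_monomial] using hsmul (coeff s x) _ h1

/-- By bilinearity it suffices to treat monomials, where the Leibniz rule on polynomials and
`op_monomialValue_monomialValue` produce the same list of terms. -/
theorem polyValue_mul_polyDeriv (f : X → V) (a : A) {x y : MvPolynomial (X × Multiset A) K}
    (hx : x ∈ populatedPoly K A X) (hy : y ∈ populatedPoly K A X) :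
    polyValue K f (x * polyDeriv K a y) = op (K := K) a (polyValue K f x) (polyValue K f y) := by
  refine populatedPoly_induction (p := fun x => polyValue K f (x * polyDeriv K a y) =
    op (K := K) a (polyValue K f x) (polyValue K f y)) (by simp) ?_ ?_ ?_ hx
  · intro x y hx hy
    simp only [add_mul, map_add, hx, hy, LinearMap.add_apply]
  · intro r x hx
    simp only [smul_mul_assoc, map_smul, hx, LinearMap.smul_apply]
  intro Φ Λ hΦ hw
  refine populatedPoly_induction (p := fun y => polyValue K f (_ * polyDeriv K a y) =
    op (K := K) a (polyValue K f _) (polyValue K f y)) (by simp) ?_ ?_ ?_ hy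
  · intro x y hx hy
    simp only [mul_add, map_add, hx, hy]
  · intro r x hx
    simp only [mul_smul_comm, map_smul, hx, Derivation.map_smul]
  intro Φ' Λ' hΦ' _
  rw [polyValue_list_prod, polyValue_list_prod, polyDeriv_list_prod,
    op_monomialValue_monomialValue f a hΦ hΦ' Λ Λ' hw, ← List.sum_map_mul_left, map_list_sum,
    List.map_map]
  refine congrArg _ (List.map_congr_left fun ν _ => ?_)
  rw [Function.comp_apply, ← List.prod_append, ← List.map_append, polyValue_list_prod]

theorem map_polyValue {C : Type*} [CommRing C] [Algebra K C] {Θ : V →ₗ[K] C}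
    {D : A → Derivation K C C}
    (hΘ : ∀ a x y, Θ (op (K := K) a x y) = Θ x * D a (Θ y)) {f : X → V}
    (ψ : MvPolynomial (X × Multiset A) K →ₐ[K] C)
    (hψ : ∀ x, Θ (f x) = ψ (MvPolynomial.X (x, 0)))
    (hD : ∀ a y, D a (ψ y) = ψ (polyDeriv K a y))
    {y : MvPolynomial (X × Multiset A) K} (hy : y ∈ populatedPoly K A X) :
    Θ (polyValue K f y) = ψ y := by
  refine populatedPoly_induction (p := fun y => Θ (polyValue K f y) = ψ y) (by simp) ?_ ?_ ?_ hy
  · intro x y hx hy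
    simp only [map_add, hx, hy]
  · intro r x hx
    simp only [map_smul, hx]
  intro Φ Λ hΦ hw
  rw [polyValue_list_prod, map_monomialValue hΘ (Z := fun i => ψ (MvPolynomial.X i)) hψ
    (fun a x w => by rw [hD, polyDeriv_X]) hΦ Λ hw, map_list_prod, List.map_map]
  rfl

end Polynomials

end MultiNovikovAlgebra

/-! ### A basis of the word algebra -/

namespace SPDEWordAlgebra

variable {K : Type*} [Field K] {d : ℕ}

theorem mul_ofFn_pow_prod {M : Type*} [Monoid M] {m : ℕ} (g : Fin m → M)
    (hg : ∀ i j, Commute (g i) (g j)) (i : Fin m) (k : Fin m → ℕ) :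
    g i * (List.ofFn fun j => g j ^ k j).prod =
      (List.ofFn fun j => g j ^ (k + Pi.single i 1 : Fin m → ℕ) j).prod := by
  induction m with
  | zero => exact i.elim0
  | succ m ih =>
    rw [List.ofFn_succ, List.ofFn_succ, List.prod_cons, List.prod_cons]
    cases i using Fin.cases with
    | zero => simp [← mul_assoc, pow_succ']
    | succ i =>
      have h := ih (fun j => g j.succ) (fun _ _ => hg _ _) i (fun j => k j.succ)
      rw [← mul_assoc, ((hg i.succ 0).pow_right _).eq, mul_assoc, h]
      have h0 : (k + Pi.single i.succ 1 : Fin (m + 1) → ℕ) 0 = k 0 := by simp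
      have h1 : ∀ j : Fin m, (k + Pi.single i.succ 1 : Fin (m + 1) → ℕ) j.succ =
          ((fun j => k j.succ) + Pi.single i 1 : Fin m → ℕ) j := fun j => by
        by_cases hj : j = i
        · subst hj; simp
        · simp [hj]
      simp only [h0, h1]

theorem letter_der_mul_derPow (i : Fin (d + 1)) (k : Fin (d + 1) → ℕ) :
    letter K (.der i) * derPow K k = derPow K (k + Pi.single i 1) :=
  mul_ofFn_pow_prod _ (fun i j => letter_der_der K i j) i k

/-- The element `n₁ ⋯ n_r d_0^{k_0} ⋯ d_d^{k_d}` of the word algebra. -/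
noncomputable def normalWord (K : Type*) [Field K] {d : ℕ} (w : Multiset (Fin (d + 1) → ℕ))
    (k : Fin (d + 1) → ℕ) : SPDEWordAlgebra K d :=
  (w.toList.map fun n => letter K (.jet n)).prod * derPow K k

theorem normalWord_zero (k : Fin (d + 1) → ℕ) : normalWord K 0 k = derPow K k := by
  simp [normalWord]

theorem normalWord_cons (n : Fin (d + 1) → ℕ) (w : Multiset (Fin (d + 1) → ℕ))
    (k : Fin (d + 1) → ℕ) :
    normalWord K (n ::ₘ w) k = letter K (.jet n) * normalWord K w k := by
  have p : (n ::ₘ w).toList.Perm (n :: w.toList) := by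
    rw [← Multiset.coe_eq_coe, Multiset.coe_toList, ← Multiset.cons_coe, Multiset.coe_toList]
  have h := (p.map fun n => letter K (.jet n)).prod_eq'
    (List.pairwise_of_forall_mem_list fun a ha b hb => by
      obtain ⟨n, -, rfl⟩ := List.mem_map.1 ha
      obtain ⟨n', -, rfl⟩ := List.mem_map.1 hb
      exact letter_jet_jet K n n')
  rw [normalWord, h, List.map_cons, List.prod_cons, mul_assoc, normalWord]

/-- The span of the elements `n₁ ⋯ n_r d_0^{k_0} ⋯ d_d^{k_d}` with fixed `r`. -/
noncomputable def normalSpan (K : Type*) [Field K] (d r : ℕ) : Submodule K (SPDEWordAlgebra K d) :=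
  Submodule.span K {x | ∃ w k, w.card = r ∧ normalWord K w k = x}

theorem normalWord_mem (w : Multiset (Fin (d + 1) → ℕ)) (k : Fin (d + 1) → ℕ) :
    normalWord K w k ∈ normalSpan K d w.card :=
  Submodule.subset_span ⟨w, k, rfl, rfl⟩

theorem letter_jet_mul_mem (n : Fin (d + 1) → ℕ) {r : ℕ} {x : SPDEWordAlgebra K d}
    (hx : x ∈ normalSpan K d r) : letter K (.jet n) * x ∈ normalSpan K d (r + 1) := by
  induction hx using Submodule.span_induction with
  | mem x h =>
    obtain ⟨w, k, rfl, rfl⟩ := h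
    rw [← normalWord_cons, ← Multiset.card_cons n w]
    exact normalWord_mem _ _
  | zero => simp
  | add x y _ _ hx hy => rw [mul_add]; exact add_mem hx hy
  | smul r x _ hx => rw [mul_smul_comm]; exact Submodule.smul_mem _ _ hx

/-- Commuting `d_i` past a letter `n` replaces `n` by another letter or leaves it, so the number of
jet letters never changes; this is what makes weight compatible with normal ordering. -/
theorem letter_der_mul_normalWord_mem (i : Fin (d + 1)) (w : Multiset (Fin (d + 1) → ℕ))
    (k : Fin (d + 1) → ℕ) : letter K (.der i) * normalWord K w k ∈ normalSpan K d w.card := by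
  induction w using Multiset.induction with
  | empty =>
    rw [normalWord_zero, letter_der_mul_derPow, ← normalWord_zero]
    exact normalWord_mem _ _
  | cons n w ih =>
    rw [normalWord_cons, ← mul_assoc, letter_der_jet, add_mul, smul_mul_assoc, mul_assoc,
      Multiset.card_cons]
    exact add_mem (Submodule.smul_mem _ _ (letter_jet_mul_mem _ (normalWord_mem _ _)))
      (letter_jet_mul_mem _ ih)

theorem letter_der_mul_mem (i : Fin (d + 1)) {r : ℕ} {x : SPDEWordAlgebra K d}
    (hx : x ∈ normalSpan K d r) : letter K (.der i) * x ∈ normalSpan K d r := by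
  induction hx using Submodule.span_induction with
  | mem x h =>
    obtain ⟨w, k, rfl, rfl⟩ := h
    exact letter_der_mul_normalWord_mem i w k
  | zero => simp
  | add x y _ _ hx hy => rw [mul_add]; exact add_mem hx hy
  | smul r x _ hx => rw [mul_smul_comm]; exact Submodule.smul_mem _ _ hx

theorem derPow_zero : derPow K (0 : Fin (d + 1) → ℕ) = 1 := by
  simp [derPow]

theorem word_mem_normalSpan (w : List (SPDELetter d)) :
    word K w ∈ normalSpan K d (SPDELetter.jetLength w) := by
  induction w with
  | nil =>
    have : word K ([] : List (SPDELetter d)) = normalWord K 0 0 := by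
      rw [normalWord_zero, derPow_zero]; rfl
    rw [this]
    exact Submodule.subset_span ⟨0, 0, Multiset.card_zero, rfl⟩
  | cons c w ih =>
    have : word K (c :: w) = letter K c * word K w := by simp [word]
    rw [this]
    cases c with
    | jet n => exact letter_jet_mul_mem n ih
    | der i => exact letter_der_mul_mem i ih

/-- Stability under left multiplication by letters extends to the whole algebra they generate, so
`N` is a left ideal containing `1`. -/
theorem eq_top_of_letter_mul_mem (N : Submodule K (SPDEWordAlgebra K d)) (h1 : 1 ∈ N)
    (hletter : ∀ c, ∀ x ∈ N, letter K c * x ∈ N) : N = ⊤ := by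
  have h : ∀ a : FreeAlgebra K (SPDELetter d), ∀ x ∈ N,
      RingQuot.mkAlgHom K (SPDEWordRel K d) a * x ∈ N := by
    intro a
    induction a using FreeAlgebra.induction with
    | grade0 r =>
      intro x hx
      rw [Algebra.algebraMap_eq_smul_one, map_smul, map_one, smul_mul_assoc, one_mul]
      exact N.smul_mem _ hx
    | grade1 c => exact hletter c
    | mul a b ha hb =>
      intro x hx
      rw [map_mul, mul_assoc]
      exact ha _ (hb _ hx)
    | add a b ha hb =>
      intro x hx
      rw [map_add, add_mul]
      exact add_mem (ha _ hx) (hb _ hx)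
  refine eq_top_iff.2 fun x _ => ?_
  obtain ⟨a, rfl⟩ := RingQuot.mkAlgHom_surjective K (SPDEWordRel K d) x
  simpa using h a 1 h1

theorem normalSpan_le (r : ℕ) : normalSpan K d r ≤
    Submodule.span K (Set.range fun p : Multiset (Fin (d + 1) → ℕ) × (Fin (d + 1) → ℕ) =>
      normalWord K p.1 p.2) := by
  refine Submodule.span_mono fun x hx => ?_
  obtain ⟨w, k, -, h⟩ := hx
  exact ⟨(w, k), h⟩

theorem span_normalWord :
    Submodule.span K (Set.range fun p : Multiset (Fin (d + 1) → ℕ) × (Fin (d + 1) → ℕ) =>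
      normalWord K p.1 p.2) = ⊤ := by
  refine eq_top_of_letter_mul_mem _ ?_ fun c x hx => ?_
  · exact Submodule.subset_span ⟨(0, 0), by simp only [normalWord_zero, derPow_zero]⟩
  · induction hx using Submodule.span_induction with
    | mem x h =>
      obtain ⟨p, rfl⟩ := h
      cases c with
      | jet n => exact normalSpan_le _ (letter_jet_mul_mem n (normalWord_mem _ _))
      | der i => exact normalSpan_le _ (letter_der_mul_mem i (normalWord_mem _ _))
    | zero => simp
    | add x y _ _ hx hy => rw [mul_add]; exact add_mem hx hy
    | smul r x _ hx => rw [mul_smul_comm]; exact Submodule.smul_mem _ _ hx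

/-! ### Linear independence of normal words through a representation on polynomials -/

open MvPolynomial

/-- The derivation of the polynomial algebra on all letters by which `d_i` acts on the letters
`n`. -/
noncomputable def derDerivation (K : Type*) [Field K] {d : ℕ} (i : Fin (d + 1)) :
    Derivation K (MvPolynomial (SPDELetter d) K) (MvPolynomial (SPDELetter d) K) :=
  mkDerivation K fun
    | .jet n => (n i : K) • X (.jet (n - Pi.single i 1))
    | .der _ => 0

theorem derDerivation_jet (i : Fin (d + 1)) (n : Fin (d + 1) → ℕ) :
    derDerivation K i (X (.jet n)) = (n i : K) • X (.jet (n - Pi.single i 1)) :=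
  mkDerivation_X _ _ _

theorem derDerivation_der (i j : Fin (d + 1)) :
    derDerivation K i (X (.der j) : MvPolynomial (SPDELetter d) K) = 0 :=
  mkDerivation_X _ _ _

theorem derDerivation_comm (i j : Fin (d + 1)) (p : MvPolynomial (SPDELetter d) K) :
    derDerivation K i (derDerivation K j p) = derDerivation K j (derDerivation K i p) := by
  have h : ⁅derDerivation K i, derDerivation (d := d) K j⁆ = 0 := by
    refine MvPolynomial.derivation_ext fun c => ?_
    rw [Derivation.commutator_apply, Derivation.zero_apply, sub_eq_zero]
    cases c with
    | der l => simp only [derDerivation_der, map_zero]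
    | jet n =>
      by_cases hij : i = j
      · rw [hij]
      -- For `i ≠ j`, lowering one coordinate does not affect the coefficient taken from the other.
      · simp only [derDerivation_jet, Derivation.map_smul, smul_smul, Pi.sub_apply,
          Pi.single_eq_of_ne hij, Pi.single_eq_of_ne (Ne.symm hij), tsub_zero]
        rw [mul_comm, tsub_right_comm]
  rw [← sub_eq_zero, ← Derivation.commutator_apply, h, Derivation.zero_apply]

/-- The action of the letters on the polynomial algebra on all letters. -/
noncomputable def letterEnd (K : Type*) [Field K] {d : ℕ} :
    SPDELetter d → Module.End K (MvPolynomial (SPDELetter d) K)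
  | .jet n => LinearMap.mulLeft K (X (.jet n))
  | .der i => LinearMap.mulLeft K (X (.der i)) + (derDerivation K i).toLinearMap

theorem letterEnd_jet (n : Fin (d + 1) → ℕ) (p : MvPolynomial (SPDELetter d) K) :
    letterEnd K (.jet n) p = X (.jet n) * p := rfl

theorem letterEnd_der (i : Fin (d + 1)) (p : MvPolynomial (SPDELetter d) K) :
    letterEnd K (.der i) p = X (.der i) * p + derDerivation K i p := rfl

/-- The action of the word algebra on the polynomial algebra on all letters. -/
noncomputable def polyRep (K : Type*) [Field K] (d : ℕ) :
    SPDEWordAlgebra K d →ₐ[K] Module.End K (MvPolynomial (SPDELetter d) K) :=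
  RingQuot.liftAlgHom K ⟨FreeAlgebra.lift K (letterEnd K), by
    intro x y h
    induction h with
    | der_der i j =>
      refine LinearMap.ext fun p => ?_
      simp only [map_mul, FreeAlgebra.lift_ι_apply, Module.End.mul_apply, letterEnd_der, map_add,
        Derivation.leibniz, derDerivation_der, derDerivation_comm i j, smul_eq_mul]
      ring
    | jet_jet n n' =>
      refine LinearMap.ext fun p => ?_
      simp only [map_mul, FreeAlgebra.lift_ι_apply, Module.End.mul_apply, letterEnd_jet]
      ring
    | der_jet i n =>
      refine LinearMap.ext fun p => ?_
      simp only [map_mul, map_add, map_smul, FreeAlgebra.lift_ι_apply, Module.End.mul_apply,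
        letterEnd_jet, letterEnd_der, Derivation.leibniz, derDerivation_jet, LinearMap.add_apply,
        LinearMap.smul_apply, smul_eq_mul, smul_mul_assoc, mul_comm p]
      ring⟩

theorem polyRep_letter (c : SPDELetter d) : polyRep K d (letter K c) = letterEnd K c := by
  simp [polyRep, letter]

/-- Starting from `1`, only polynomials in the variables `d_i` occur, and on these the derivation
part of the action vanishes (`h0`). -/
theorem polyRep_derPow (k : Fin (d + 1) → ℕ) :
    polyRep K d (derPow K k) 1 = ∏ i, X (.der i) ^ k i := by
  set S : MvPolynomial (Fin (d + 1)) K →ₐ[K] MvPolynomial (SPDELetter d) K := rename .der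
  have h0 : ∀ i q, derDerivation K i (S q) = 0 := by
    intro i q
    induction q using MvPolynomial.induction_on with
    | C r => simp [S, ← algebraMap_eq]
    | add p q hp hq => rw [map_add, map_add, hp, hq, add_zero]
    | mul_X p j hp =>
      rw [map_mul, Derivation.leibniz, hp, rename_X, derDerivation_der, smul_zero, smul_zero,
        add_zero]
  have h1 : ∀ (i : Fin (d + 1)) (m : ℕ) q,
      polyRep K d (letter K (.der i) ^ m) (S q) = S (X i ^ m * q) := by
    intro i m
    induction m with
    | zero => simp
    | succ m ih =>
      intro q
      rw [pow_succ, map_mul, Module.End.mul_apply, polyRep_letter, letterEnd_der, h0, add_zero,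
        ← rename_X SPDELetter.der, ← map_mul, ih, pow_succ, mul_assoc]
  have h2 : ∀ (l : List (Fin (d + 1))) q,
      polyRep K d (l.map fun i => letter K (.der i) ^ k i).prod (S q) =
        S ((l.map fun i => X i ^ k i).prod * q) := by
    intro l
    induction l with
    | nil => simp
    | cons i l ih =>
      intro q
      rw [List.map_cons, List.prod_cons, map_mul, Module.End.mul_apply, ih, h1, List.map_cons,
        List.prod_cons, mul_assoc]
  have h3 := h2 (List.finRange (d + 1)) 1
  rw [map_one, mul_one, ← List.ofFn_eq_map, ← List.ofFn_eq_map, List.prod_ofFn, map_prod] at h3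
  rw [derPow, h3]
  simp [S]

/-- The exponent of the monomial corresponding to `n₁ ⋯ n_r d_0^{k_0} ⋯ d_d^{k_d}`. -/
noncomputable def normalExponent {d : ℕ}
    (p : Multiset (Fin (d + 1) → ℕ) × (Fin (d + 1) → ℕ)) : SPDELetter d →₀ ℕ :=
  (p.1.map fun n => Finsupp.single (.jet n) 1).sum + ∑ i, Finsupp.single (.der i) (p.2 i)

theorem normalExponent_injective : Function.Injective (normalExponent (d := d)) := by
  classical
  have hjet : ∀ (p : Multiset (Fin (d + 1) → ℕ) × (Fin (d + 1) → ℕ)) n,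
      normalExponent p (.jet n) = p.1.count n := by
    rintro ⟨w, k⟩ n
    induction w using Multiset.induction with
    | empty => simp [normalExponent, Finsupp.finsetSum_apply]
    | cons m w ih =>
      simp only [normalExponent, Multiset.map_cons, Multiset.sum_cons, Finsupp.add_apply,
        add_assoc, Multiset.count_cons] at ih ⊢
      rw [ih, Finsupp.single_apply, add_comm]
      simp [eq_comm]
  have hder : ∀ (p : Multiset (Fin (d + 1) → ℕ) × (Fin (d + 1) → ℕ)) i,
      normalExponent p (.der i) = p.2 i := by
    rintro ⟨w, k⟩ i
    induction w using Multiset.induction with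
    | empty => simp [normalExponent, Finsupp.finsetSum_apply, Finsupp.single_apply]
    | cons m w ih =>
      simp only [normalExponent, Multiset.map_cons, Multiset.sum_cons, Finsupp.add_apply,
        add_assoc] at ih ⊢
      rw [ih]
      simp
  intro p q h
  refine Prod.ext (Multiset.ext.2 fun n => ?_) (funext fun i => ?_)
  · rw [← hjet, ← hjet, h]
  · rw [← hder, ← hder, h]

theorem polyRep_normalWord (p : Multiset (Fin (d + 1) → ℕ) × (Fin (d + 1) → ℕ)) :
    polyRep K d (normalWord K p.1 p.2) 1 = MvPolynomial.monomial (normalExponent p) 1 := by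
  obtain ⟨w, k⟩ := p
  induction w using Multiset.induction with
  | empty =>
    simp only [normalWord_zero, polyRep_derPow, normalExponent, Multiset.map_zero,
      Multiset.sum_zero, zero_add, MvPolynomial.monomial_sum_one, X_pow_eq_monomial]
  | cons n w ih =>
    simp only at ih
    rw [normalWord_cons, map_mul, Module.End.mul_apply, polyRep_letter, letterEnd_jet, ih, X,
      monomial_mul, one_mul]
    simp only [normalExponent, Multiset.map_cons, Multiset.sum_cons, add_assoc]

/-- Acting on `1` sends distinct normal words to distinct monomials. -/
theorem linearIndependent_normalWord :
    LinearIndependent K fun p : Multiset (Fin (d + 1) → ℕ) × (Fin (d + 1) → ℕ) =>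
      normalWord K p.1 p.2 := by
  refine LinearIndependent.of_comp
    ((LinearMap.applyₗ (1 : MvPolynomial (SPDELetter d) K)) ∘ₗ (polyRep K d).toLinearMap) ?_
  have h : ((LinearMap.applyₗ (1 : MvPolynomial (SPDELetter d) K)) ∘ₗ
      (polyRep K d).toLinearMap) ∘ (fun p => normalWord K p.1 p.2) =
      basisMonomials (SPDELetter d) K ∘ normalExponent := by
    funext p
    simpa using polyRep_normalWord p
  rw [h]
  exact (basisMonomials _ _).linearIndependent.comp _ normalExponent_injective

/-- The basis of the word algebra consisting of the elements `n₁ ⋯ n_r d_0^{k_0} ⋯ d_d^{k_d}`. -/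
noncomputable def normalBasis (K : Type*) [Field K] (d : ℕ) :
    Module.Basis (Multiset (Fin (d + 1) → ℕ) × (Fin (d + 1) → ℕ)) K (SPDEWordAlgebra K d) :=
  Module.Basis.mk linearIndependent_normalWord span_normalWord.ge

theorem normalBasis_apply (w : Multiset (Fin (d + 1) → ℕ)) (k : Fin (d + 1) → ℕ) :
    normalBasis K d (w, k) = normalWord K w k :=
  Module.Basis.mk_apply _ _ _

theorem jetLength_append (w w' : List (SPDELetter d)) :
    SPDELetter.jetLength (w ++ w') = SPDELetter.jetLength w + SPDELetter.jetLength w' := by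
  induction w with
  | nil => simp [SPDELetter.jetLength]
  | cons c w ih =>
    cases c <;> simp only [List.cons_append, SPDELetter.jetLength, ih]
    omega

theorem exists_word_eq_derPow (k : Fin (d + 1) → ℕ) :
    ∃ w : List (SPDELetter d), SPDELetter.jetLength w = 0 ∧ word K w = derPow K k := by
  let S : Submonoid (SPDEWordAlgebra K d) :=
    { carrier := {x | ∃ w, SPDELetter.jetLength w = 0 ∧ word K w = x}
      one_mem' := ⟨[], rfl, rfl⟩
      mul_mem' := by
        rintro _ _ ⟨w, hw, rfl⟩ ⟨w', hw', rfl⟩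
        exact ⟨w ++ w', by rw [jetLength_append, hw, hw'], by simp [word]⟩ }
  have h : derPow K k ∈ S := by
    refine Submonoid.list_prod_mem _ fun x hx => ?_
    obtain ⟨i, rfl⟩ := (List.mem_ofFn' _ _).1 hx
    exact pow_mem (show letter K (.der i) ∈ S from ⟨[.der i], rfl, by simp [word]⟩) _
  exact h

end SPDEWordAlgebra

/-! ### Populated multi-indices as polynomials of weight one -/

namespace SPDEMultiIndexAlgebra

open SPDEWordAlgebra MultiNovikovAlgebra

variable {K : Type*} [Field K] {d : ℕ} {L : Type*}

/-- The basis of the space of variables consisting of the `z_{(l, n₁ ⋯ n_r d^k)}`. -/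
noncomputable def variableBasis (K : Type*) [Field K] (d : ℕ) (L : Type*) :
    Module.Basis (((Fin (d + 1) → ℕ) × L) × Multiset (Fin (d + 1) → ℕ)) K
      (L →₀ SPDEWordAlgebra K d) :=
  (Finsupp.basis fun _ : L => normalBasis K d).reindex
    { toFun := fun i => ((i.2.2, i.1), i.2.1)
      invFun := fun i => ⟨i.1.2, (i.2, i.1.1)⟩
      left_inv := fun _ => rfl
      right_inv := fun _ => rfl }

theorem variableBasis_apply (k : Fin (d + 1) → ℕ) (l : L) (w : Multiset (Fin (d + 1) → ℕ)) :
    variableBasis K d L ((k, l), w) = Finsupp.single l (normalWord K w k) := by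
  simp [variableBasis, normalBasis_apply]

/-- The algebra of SPDE multi-indices as a polynomial algebra. -/
noncomputable def polyEquiv (K : Type*) [Field K] (d : ℕ) (L : Type*) :
    SPDEMultiIndexAlgebra K d L ≃ₐ[K]
      MvPolynomial (((Fin (d + 1) → ℕ) × L) × Multiset (Fin (d + 1) → ℕ)) K :=
  SymmetricAlgebra.equivMvPolynomial (variableBasis K d L)

theorem polyEquiv_z (k : Fin (d + 1) → ℕ) (l : L) (w : Multiset (Fin (d + 1) → ℕ)) :
    polyEquiv K d L (z l (normalWord K w k)) = MvPolynomial.X ((k, l), w) := by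
  have h : z l (normalWord K w k) =
      SymmetricAlgebra.ι K (L →₀ SPDEWordAlgebra K d) (variableBasis K d L ((k, l), w)) := by
    rw [variableBasis_apply]; rfl
  rw [h]
  exact SymmetricAlgebra.equivMvPolynomial_ι_apply _ _

theorem polyEquiv_symm_X (i : ((Fin (d + 1) → ℕ) × L) × Multiset (Fin (d + 1) → ℕ)) :
    (polyEquiv K d L).symm (MvPolynomial.X i) = z i.1.2 (normalWord K i.2 i.1.1) := by
  rw [AlgEquiv.symm_apply_eq, polyEquiv_z]

theorem D_polyEquiv_symm (n : Fin (d + 1) → ℕ)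
    (p : MvPolynomial (((Fin (d + 1) → ℕ) × L) × Multiset (Fin (d + 1) → ℕ)) K) :
    D K L n ((polyEquiv K d L).symm p) = (polyEquiv K d L).symm (polyDeriv K n p) := by
  induction p using MvPolynomial.induction_on with
  | C r => rw [← MvPolynomial.algebraMap_eq, AlgEquiv.commutes, Derivation.map_algebraMap,
      Derivation.map_algebraMap, map_zero]
  | add p q hp hq => simp only [map_add, hp, hq]
  | mul_X p i hp =>
    simp only [map_mul, map_add, Derivation.leibniz, hp, polyEquiv_symm_X, polyDeriv_X,
      smul_eq_mul, letterDerivation_z, normalWord_cons]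

theorem polyEquiv_D (n : Fin (d + 1) → ℕ) (x : SPDEMultiIndexAlgebra K d L) :
    polyEquiv K d L (D K L n x) = polyDeriv K n (polyEquiv K d L x) := by
  have h := D_polyEquiv_symm n (polyEquiv K d L x)
  rwa [AlgEquiv.symm_apply_apply, AlgEquiv.eq_symm_apply] at h

theorem polyEquiv_z_word_mem (l : L) (w : List (SPDELetter d)) :
    MvPolynomial.IsWeightedHomogeneous
      (fun i : ((Fin (d + 1) → ℕ) × L) × Multiset (Fin (d + 1) → ℕ) => 1 - (i.2.card : ℤ))
      (polyEquiv K d L (z l (word K w))) (1 - (SPDELetter.jetLength w : ℤ)) := by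
  have h : ∀ r : ℕ, normalSpan K d r ≤ (MvPolynomial.weightedHomogeneousSubmodule K
      (fun i : ((Fin (d + 1) → ℕ) × L) × Multiset (Fin (d + 1) → ℕ) => 1 - (i.2.card : ℤ))
      (1 - (r : ℤ))).comap ((polyEquiv K d L).toLinearMap ∘ₗ z l) := by
    intro r
    refine Submodule.span_le.2 ?_
    rintro _ ⟨w, k, rfl, rfl⟩
    simp only [SetLike.mem_coe, Submodule.mem_comap, LinearMap.comp_apply,
      AlgEquiv.toLinearMap_apply, polyEquiv_z]
    exact MvPolynomial.isWeightedHomogeneous_X _ _ _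
  exact h _ (word_mem_normalSpan w)

/-- Each `z_{(l,w)}` is homogeneous of weight `1 - |w|` after normal ordering. Only this inclusion
is needed, since the inverse map is restricted to populated elements and surjectivity follows from
`Φ ∘ Ψ = id`. -/
theorem polyEquiv_mem {x : SPDEMultiIndexAlgebra K d L} (hx : x ∈ populated K d L) :
    polyEquiv K d L x ∈ populatedPoly K (Fin (d + 1) → ℕ) ((Fin (d + 1) → ℕ) × L) := by
  have h : populated K d L ≤ (populatedPoly K (Fin (d + 1) → ℕ) ((Fin (d + 1) → ℕ) × L)).comap
      (polyEquiv K d L).toLinearMap := by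
    refine Submodule.span_le.2 ?_
    rintro _ ⟨β, hβ, rfl⟩
    have h := MvPolynomial.IsWeightedHomogeneous.prod β.support
      (fun p => polyEquiv K d L (z p.1 (word K p.2)) ^ β p)
      (fun p => β p • (1 - (SPDELetter.jetLength p.2 : ℤ)))
      (fun p _ => (polyEquiv_z_word_mem p.1 p.2).pow (β p))
    have e : ∑ p ∈ β.support, β p • (1 - (SPDELetter.jetLength p.2 : ℤ)) = 1 := by
      refine Eq.trans ?_ hβ
      rw [weight, Finsupp.sum]
      exact Finset.sum_congr rfl fun p _ => by rw [nsmul_eq_mul, mul_comm]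
    rw [e] at h
    simpa [populatedPoly, monomial, Finsupp.prod, MvPolynomial.mem_weightedHomogeneousSubmodule]
      using h
  exact h hx

theorem z_derPow_mem (l : L) (k : Fin (d + 1) → ℕ) :
    z l (derPow K k) ∈ populated K d L := by
  obtain ⟨w, hw, e⟩ := exists_word_eq_derPow (K := K) k
  refine Submodule.subset_span ⟨Finsupp.single (l, w) 1, ?_, ?_⟩
  · simp [weight, hw]
  · simp [monomial, e]

end SPDEMultiIndexAlgebra

/-! ### The isomorphism -/

open SPDEMultiIndexAlgebra SPDEWordAlgebra in
theorem theorem4p2 (K : Type*) [Field K] (d : ℕ) (L : Type*) :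
    ∃ φ : MultiNovikovEquiv K (Fin (d + 1) → ℕ)
        (FreeMultiNovikov K (Fin (d + 1) → ℕ) ((Fin (d + 1) → ℕ) × L))
        (SPDEMultiIndexAlgebra.populated K d L),
      ∀ (k : Fin (d + 1) → ℕ) (l : L),
        (φ.toLinearEquiv (FreeMultiNovikov.of K (Fin (d + 1) → ℕ) (k, l)) :
            SPDEMultiIndexAlgebra K d L) =
          SPDEMultiIndexAlgebra.z l (SPDEWordAlgebra.derPow K k) := by
  let F := FreeMultiNovikov K (Fin (d + 1) → ℕ) ((Fin (d + 1) → ℕ) × L)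
  let gen : (Fin (d + 1) → ℕ) × L → F := FreeMultiNovikov.of K (Fin (d + 1) → ℕ)
  obtain ⟨Φ, ⟨hΦ, hΦ'⟩, -⟩ := FreeMultiNovikov.existsUnique_lift K
    (A := Fin (d + 1) → ℕ) (V := populated K d L)
    (fun x : (Fin (d + 1) → ℕ) × L => ⟨z x.2 (derPow K x.1), z_derPow_mem x.2 x.1⟩)
  let Ψ : populated K d L →ₗ[K] F :=
    MultiNovikovAlgebra.polyValue K gen ∘ₗ (polyEquiv K d L).toLinearMap ∘ₗ
      (populated K d L).subtype
  have hgen : ∀ x : (Fin (d + 1) → ℕ) × L, polyEquiv K d L (z x.2 (derPow K x.1)) =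
      MvPolynomial.X (x, 0) := fun x => by
    rw [← normalWord_zero, polyEquiv_z]
  have hΨ : ∀ (a : Fin (d + 1) → ℕ) (x y : populated K d L), Ψ (MultiNovikovAlgebra.op (K := K) a x y) =
      MultiNovikovAlgebra.op (K := K) a (Ψ x) (Ψ y) := by
    intro a x y
    have h := MultiNovikovAlgebra.polyValue_mul_polyDeriv gen a (polyEquiv_mem x.2)
      (polyEquiv_mem y.2)
    rw [← polyEquiv_D, ← map_mul, ← coe_op] at h
    exact h
  -- Both sides are endomorphisms of the free algebra respecting the products and fixing the
  -- generators.
  have hΨΦ : Ψ ∘ₗ Φ = LinearMap.id := by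
    refine (FreeMultiNovikov.existsUnique_lift K gen).unique ⟨fun a x y => ?_, fun x => ?_⟩
      ⟨fun a x y => rfl, fun x => rfl⟩
    · rw [LinearMap.comp_apply, hΦ, hΨ]; rfl
    · rw [LinearMap.comp_apply, hΦ']
      exact (congrArg (MultiNovikovAlgebra.polyValue K gen) (hgen x)).trans
        (MultiNovikovAlgebra.polyValue_X gen x)
  -- Composing `Φ` with the inclusion gives a map into a commutative algebra turning `▷ₙ` into `x *
  -- D^{(n)} y`, so `map_polyValue` applies with the inverse of `polyEquiv` as `ψ`.
  have hΦΨ : Φ ∘ₗ Ψ = LinearMap.id := by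
    refine LinearMap.ext fun y => Subtype.ext ?_
    have h := MultiNovikovAlgebra.map_polyValue (Θ := (populated K d L).subtype ∘ₗ Φ)
      (D := fun n => D K L n) (f := gen)
      (fun a x y => by rw [LinearMap.comp_apply, hΦ]; rfl) (polyEquiv K d L).symm.toAlgHom
      (fun x => by
        rw [LinearMap.comp_apply, hΦ']
        exact ((AlgEquiv.symm_apply_eq _).2 (hgen x).symm).symm)
      (fun a y => D_polyEquiv_symm a y) (polyEquiv_mem y.2)
    exact h.trans (AlgEquiv.symm_apply_apply _ _)
  refine ⟨{ toLinearEquiv := LinearEquiv.ofLinearMap Φ Ψ hΦΨ hΨΦ, map_op := hΦ }, fun k l => ?_⟩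
  exact congrArg Subtype.val (hΦ' (k, l))
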